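/- Let $\Omega:=\mathbb{R}^2\times(0,\infty)$ and let $BV(\Omega;\{0,1\})$ be the class of measurable sets $E\subset\Omega$ of finite Lebesgue measure and of finite perimeter $P(E,\Omega)$ in $\Omega$, each identified with its set $E^{(1)}$ of points of Lebesgue density one. For $E,E_0\in BV(\Omega;\{0,1\})$, $\tau>0$ and $\beta\in L^\infty(\partial\Omega)$ put $$\mathcal{F}_\beta(E;E_0,\tau):=P(E,\Omega)+\int_{\partial\Omega}\beta\,\chi_E\,d\mathcal{H}^2+\frac1\tau\int_{E\Delta E_0}\mathrm{dist}(x,\Omega\cap\partial^*E_0)\,dx,$$ where $\chi_E$ on $\partial\Omega$ is understood in the sense of traces, $\partial^*E_0$ is the reduced boundary of $E_0$, and $\mathrm{dist}(x,\emptyset)=+\infty$. A minimizer of $\mathcal{F}_\beta(\cdot;E_0,\tau)$ is a set minimizing it in $BV(\Omega;\{0,1\})$; the minimal minimizer is the minimizer contained in every other minimizer. Let $E_0,F_0\in BV(\Omega;\{0,1\})$ be bounded with $|\partial E_0|=|\partial F_0|=0$. Let $\beta_1,\beta_2\in L^\infty(\partial\Omega)$ be such that for each $i\in\{1,2\}$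 there is $\eta_i\in(0,1/2)$ with $\|\beta_i\|_\infty\le 1-2\eta_i$. Let $\tau>0$, let $E_\tau$ be a minimizer of $\mathcal{F}_{\beta_1}(\cdot;E_0,\tau)$, and let $F_{\tau*}$ be the minimal minimizer of $\mathcal{F}_{\beta_2}(\cdot;F_0,\tau)$. (a) If $F_0\subseteq E_0$ and $\beta_2\ge\beta_1$ $\mathcal{H}^2$-a.e. on $\partial\Omega$, then $F_{\tau*}\subseteq E_\tau$. (b) If $E_0\cap F_0=\emptyset$ and $\beta_1+\beta_2\ge0$ $\mathcal{H}^2$-a.e. on $\partial\Omega$, then $F_{\tau*}\cap E_\tau=\emptyset$. -/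

import Mathlib

open MeasureTheory Filter Topology

namespace CapillaryDroplet

noncomputable section

/-- Three-dimensional Euclidean space. -/
abbrev E3 : Type := EuclideanSpace ℝ (Fin 3)

/-- The open half-space `Ω = ℝ² × (0, ∞)`. -/
def halfSpace : Set E3 := {x | 0 < x 2}

/-- The boundary `∂Ω = ℝ² × {0}` of the half-space. -/
def wall : Set E3 := {x | x 2 = 0}

/-- The (normalized) two-dimensional Hausdorff measure `H²` on `∂Ω`. -/
def wallMeasure : Measure E3 := (Measure.euclideanHausdorffMeasure 2).restrict wall

/-- The divergence `∑ i, ∂ᵢ φᵢ` of a vector field. -/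
def divergence (φ : E3 → E3) (x : E3) : ℝ :=
  ∑ i : Fin 3, fderiv ℝ φ x (EuclideanSpace.single i 1) i

/-- The vector fields of class `C¹` with compact support in `U`. -/
def IsTestField (U : Set E3) (φ : E3 → E3) : Prop :=
  ContDiff ℝ 1 φ ∧ HasCompactSupport φ ∧ tsupport φ ⊆ U

/-- The perimeter `P(E, U)` of `E` in the open set `U`: the supremum of `∫_E div φ` over the
fields `φ ∈ C¹_c(U; ℝ³)` with `|φ| ≤ 1`. -/
def perimeter (E U : Set E3) : ENNReal :=
  ⨆ (φ : E3 → E3) (_ : IsTestField U φ ∧ ∀ x, ‖φ x‖ ≤ 1),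
    ENNReal.ofReal (∫ x in E, divergence φ x)

/-- The set `E^{(1)}` of the points at which `E` has Lebesgue density one. -/
def densityOne (E : Set E3) : Set E3 :=
  {x | Tendsto (fun r : ℝ => volume (E ∩ Metric.ball x r) / volume (Metric.ball x r))
    (𝓝[>] 0) (𝓝 1)}

/-- The class `BV(Ω; {0,1})`: measurable subsets of `Ω` of finite volume (the characteristic
function is in `L¹(Ω)`) and of finite perimeter in `Ω`, each represented by its set of points of
density one. -/
structure IsBVSet (E : Set E3) : Prop where
  measurableSet : MeasurableSet E
  subset : E ⊆ halfSpace
  volume_lt_top : volume E < ⊤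
  perimeter_lt_top : perimeter E halfSpace < ⊤
  densityOne_eq : densityOne E = E

/-- `m = |Dχ_E|` and `σ` are the total variation and the density of the Gauss-Green measure
`σ m = -Dχ_E` of `E` in `Ω` (so `σ` is the measure-theoretic outer unit normal). The pair is
unique (`σ` up to `m`-null sets), and it exists when `E` has finite perimeter in `Ω`. -/
structure IsGaussGreenPair (E : Set E3) (m : Measure E3) (σ : E3 → E3) : Prop where
  finite : IsFiniteMeasure m
  compl_null : m halfSpaceᶜ = 0
  measurable : Measurable σ
  norm_eq_one : ∀ᵐ x ∂m, ‖σ x‖ = 1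
  integral_eq : ∀ φ : E3 → E3, IsTestField halfSpace φ →
    ∫ x in E, divergence φ x = ∫ x, inner ℝ (φ x) (σ x) ∂m

/-- The part `Ω ∩ ∂*E` in `Ω` of the reduced boundary: the points `x ∈ Ω` of the support of
`|Dχ_E|` at which `-Dχ_E(B_r(x)) / |Dχ_E|(B_r(x))` converges to a unit vector as `r → 0⁺`. -/
def reducedBoundary (E : Set E3) : Set E3 :=
  {x | x ∈ halfSpace ∧ ∃ (m : Measure E3) (σ : E3 → E3), IsGaussGreenPair E m σ ∧
    (∀ r : ℝ, 0 < r → 0 < m (Metric.ball x r)) ∧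
    ∃ ν : E3, ‖ν‖ = 1 ∧
      Tendsto (fun r : ℝ => ⨍ y in Metric.ball x r, σ y ∂m) (𝓝[>] 0) (𝓝 ν)}

/-- The distance `d_E(x) = dist(x, Ω ∩ ∂*E)`, which is `+∞` if `Ω ∩ ∂*E` is empty. -/
def bdryDist (E : Set E3) (x : E3) : ENNReal :=
  Metric.infEDist x (reducedBoundary E)

/-- The trace of `χ_E` on `∂Ω`: the limit of the averages of `χ_E` over `Ω ∩ B_r(x)`. For sets
of finite perimeter in `Ω` the limit exists at `H²`-almost every `x ∈ ∂Ω`. -/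
def trace (E : Set E3) (x : E3) : ℝ :=
  limUnder (𝓝[>] (0 : ℝ)) fun r =>
    volume.real (E ∩ Metric.ball x r) / volume.real (halfSpace ∩ Metric.ball x r)

/-- The capillary functional `C_β(E, Ω) = P(E, Ω) + ∫_{∂Ω} β χ_E dH²`. -/
def capillary (β : E3 → ℝ) (E : Set E3) : EReal :=
  (perimeter E halfSpace : EReal) + ((∫ x, β x * trace E x ∂wallMeasure : ℝ) : EReal)

/-- The capillary Almgren-Taylor-Wang functional
`F_β(E; E₀, τ) = C_β(E, Ω) + (1/τ) ∫_{E Δ E₀} d_{E₀} dx`. -/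
def atw (β : E3 → ℝ) (E E₀ : Set E3) (τ : ℝ) : EReal :=
  capillary β E +
    ((ENNReal.ofReal (1 / τ) * ∫⁻ x in symmDiff E E₀, bdryDist E₀ x : ENNReal) : EReal)

/-- `E` minimizes `F_β(·; E₀, τ)` in `BV(Ω; {0,1})`. -/
def IsMinimizer (β : E3 → ℝ) (E₀ : Set E3) (τ : ℝ) (E : Set E3) : Prop :=
  IsBVSet E ∧ ∀ G : Set E3, IsBVSet G → atw β E E₀ τ ≤ atw β G E₀ τ

/-- `E` is the minimal minimizer of `F_β(·; E₀, τ)`: it is contained in every minimizer. -/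
def IsMinimalMinimizer (β : E3 → ℝ) (E₀ : Set E3) (τ : ℝ) (E : Set E3) : Prop :=
  IsMinimizer β E₀ τ E ∧ ∀ G : Set E3, IsMinimizer β E₀ τ G → E ⊆ G

/-- `β ∈ L^∞(∂Ω)` and `‖β‖_∞ ≤ 1 - 2η` for some `η ∈ (0, 1/2)`. -/
def IsAdhesionCoefficient (β : E3 → ℝ) : Prop :=
  MemLp β ⊤ wallMeasure ∧
    ∃ η : ℝ, 0 < η ∧ η < 1 / 2 ∧ eLpNorm β ⊤ wallMeasure ≤ ENNReal.ofReal (1 - 2 * η)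

end

end CapillaryDroplet

open MeasureTheory Filter Topology

/-! The proof is an exchange argument. For (a) the pair `(E, F)` is traded for `(E ∪ F, E ∩ F)`, for
(b) for `(E \ F, F \ E)`. If the sum of the two energies does not increase, minimality of `E` forces
the second set of the new pair to have energy at most that of `F`, so it minimizes the second
functional (`IsMinimizer.of_exchange`). The minimal minimizer `F` is then contained in `E ∩ F`,
respectively in `F \ E`, up to passing to points of density one; as the sets of the class are their
own density-one sets, the resulting inclusions hold pointwise.

The three parts of the energy are treated separately. Perimeter: submodularity
(`perimeter_union_add_perimeter_inter_le`), applied to `E` and `F` for (a) and to `E` and `Fᶜ` for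
(b). Wall energy: traces are additive on disjoint unions, so the exchange gains `∫ (β₂ - β₁) trace
(F \ E)`, respectively `∫ (β₁ + β₂) trace (E ∩ F)`. Dissipation: the inequality holds pointwise. Its
nontrivial cases compare the distances to the reduced boundaries of `E₀` and `F₀`. The key is that a
convex open subset of the half-space containing both a point of a set of the class and a point
outside it meets the reduced boundary of that set (`IsBVSet.exists_mem_reducedBoundary`).

Two facts about sets of finite perimeter are needed: a Gauss-Green pair exists, so that the reduced
boundary is as large as it should be, and the trace exists almost everywhere on the wall and is
integrable. Both follow from one statement: the distributional derivatives of `χ_E` on all of space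
are finite signed measures (`IsFinitePerimeterSet.exists_derivative_measures`). -/

namespace CapillaryDroplet

noncomputable section

open scoped CompactlySupported NNReal

/-! ### Riesz representation of bounded functionals by differences of finite measures. -/

section SignedRiesz

/-- The positive part `f ↦ sup {ℓ g | 0 ≤ g ≤ f}` of a bounded functional. -/
theorem exists_positive_part_functional {X : Type*} [TopologicalSpace X]
    (ℓ : C_c(X, ℝ≥0) → ℝ) (C : ℝ)
    (hadd : ∀ f g, ℓ (f + g) = ℓ f + ℓ g) (hsmul : ∀ (c : ℝ≥0) f, ℓ (c • f) = c * ℓ f)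
    (hC : ∀ f, (∀ x, f x ≤ 1) → |ℓ f| ≤ C) :
    ∃ P : C_c(X, ℝ≥0) → ℝ, (∀ f g, P (f + g) = P f + P g) ∧
      (∀ (c : ℝ≥0) f, P (c • f) = c * P f) ∧ (∀ f, 0 ≤ P f) ∧ (∀ f, ℓ f ≤ P f) ∧
      (∀ f, (∀ x, f x ≤ 1) → P f ≤ C) := by
  have hz : ℓ 0 = 0 := by simpa using hsmul 0 0
  have hbd : ∀ f : C_c(X, ℝ≥0), BddAbove (Set.range fun g : {g // g ≤ f} => ℓ g.1) := by
    intro f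
    obtain ⟨B, hB⟩ : ∃ B : ℝ≥0, ∀ x, f x ≤ B := by
      have : IsCompact (Set.range f) := f.hasCompactSupport.isCompact_range f.continuous
      obtain ⟨B, hB⟩ := this.bddAbove
      exact ⟨B, fun x => hB ⟨x, rfl⟩⟩
    refine ⟨(B + 1) * C, ?_⟩
    rintro _ ⟨⟨g, hg⟩, rfl⟩
    -- Dividing by `B + 1` instead of `B` brings `g` below one even when `B = 0`.
    have hB1 : (B + 1 : ℝ≥0) ≠ 0 := by positivity
    have h1 : ℓ g = (B + 1 : ℝ≥0) * ℓ ((B + 1 : ℝ≥0)⁻¹ • g) := by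
      rw [← hsmul, smul_smul, mul_inv_cancel₀ hB1, one_smul]
    have h2 : |ℓ ((B + 1 : ℝ≥0)⁻¹ • g)| ≤ C := by
      refine hC _ fun x => ?_
      have : g x ≤ B + 1 := (hg x).trans ((hB x).trans (by simp))
      simp only [CompactlySupportedContinuousMap.coe_smul, Pi.smul_apply, smul_eq_mul]
      rw [inv_mul_le_iff₀ (by positivity)]
      simpa using this
    dsimp only
    rw [h1]
    push_cast
    exact mul_le_mul_of_nonneg_left (le_of_abs_le h2) (by positivity)
  let P : C_c(X, ℝ≥0) → ℝ := fun f => ⨆ g : {g // g ≤ f}, ℓ g.1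
  have hle : ∀ f g, g ≤ f → ℓ g ≤ P f := fun f g h => le_ciSup (hbd f) ⟨g, h⟩
  have hne : ∀ f : C_c(X, ℝ≥0), Nonempty {g // g ≤ f} := fun f => ⟨⟨f, le_rfl⟩⟩
  have hpos : ∀ f, 0 ≤ P f := fun f => by
    have := hle f 0 (fun x => by simp)
    rwa [hz] at this
  have hsm : ∀ (c : ℝ≥0) f, c * P f ≤ P (c • f) := by
    intro c f
    refine (Real.mul_iSup_of_nonneg c.coe_nonneg fun g : {g // g ≤ f} => ℓ g.1).trans_le ?_
    refine ciSup_le fun ⟨g, hg⟩ => ?_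
    rw [← hsmul]
    refine hle _ _ fun x => ?_
    exact mul_le_mul_of_nonneg_left (hg x) (by simp)
  refine ⟨P, ?_, ?_, hpos, fun f => hle f f le_rfl, ?_⟩
  · intro f₁ f₂
    apply le_antisymm
    · refine ciSup_le fun ⟨g, hg⟩ => ?_
      -- Riesz decomposition: a function below `f₁ + f₂` is the sum of `g ⊓ f₁` and a remainder `h`,
      -- which lies below `f₂`.
      obtain ⟨h, hh⟩ := CompactlySupportedContinuousMap.exists_add_of_le
        (inf_le_left : g ⊓ f₁ ≤ g)
      have e : ℓ g = ℓ (g ⊓ f₁) + ℓ h := by rw [← hadd, hh]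
      dsimp only
      rw [e]
      refine add_le_add (hle _ _ inf_le_right) (hle _ _ fun x => ?_)
      have h1 : g x ≤ f₁ x + f₂ x := hg x
      have h2 : min (g x) (f₁ x) + h x = g x := by
        have := DFunLike.congr_fun hh x
        simpa using this
      rcases le_total (g x) (f₁ x) with h3 | h3
      · rw [min_eq_left h3] at h2
        have : h x = 0 := by simpa using h2
        change h x ≤ f₂ x
        rw [this]; simp
      · rw [min_eq_right h3] at h2
        rw [← h2] at h1
        exact le_of_add_le_add_left h1
    · have : P f₁ ≤ P (f₁ + f₂) - P f₂ := by
        refine ciSup_le fun ⟨g₁, hg₁⟩ => ?_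
        rw [le_sub_comm]
        refine ciSup_le fun ⟨g₂, hg₂⟩ => ?_
        dsimp only
        rw [le_sub_iff_add_le, add_comm, ← hadd]
        exact hle _ _ fun x => add_le_add (hg₁ x) (hg₂ x)
      linarith
  · intro c f
    refine le_antisymm ?_ (hsm c f)
    rcases eq_or_ne c 0 with rfl | hc
    · refine ciSup_le fun ⟨g, hg⟩ => ?_
      have : g = 0 := by
        ext x
        have := hg x
        simpa using this
      simp [this, hz]
    · have h1 := hsm c⁻¹ (c • f)
      rw [smul_smul, inv_mul_cancel₀ hc, one_smul] at h1
      push_cast at h1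
      rwa [inv_mul_le_iff₀ (by positivity)] at h1
  · intro f hf
    exact ciSup_le fun ⟨g, hg⟩ => le_of_abs_le (hC g fun x => (hg x).trans (hf x))

variable {X : Type*} [TopologicalSpace X] [T2Space X] [LocallyCompactSpace X]
  [MeasurableSpace X] [BorelSpace X]

/-- A bounded positive functional on `C_c(X, ℝ≥0)` is represented by a finite measure. -/
theorem exists_finite_measure_of_bounded_positive (T : C_c(X, ℝ≥0) → ℝ) (C : ℝ)
    (hadd : ∀ f g, T (f + g) = T f + T g) (hsmul : ∀ (c : ℝ≥0) f, T (c • f) = c * T f)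
    (hpos : ∀ f, 0 ≤ T f) (hC : ∀ f, (∀ x, f x ≤ 1) → T f ≤ C) :
    ∃ μ : Measure X, IsFiniteMeasure μ ∧ ∀ f : C_c(X, ℝ≥0), ∫ x, (f x : ℝ) ∂μ = T f := by
  let Λ : C_c(X, ℝ≥0) →ₗ[ℝ≥0] ℝ≥0 :=
    { toFun := fun f => ⟨T f, hpos f⟩
      map_add' := fun f g => NNReal.eq (hadd f g)
      map_smul' := fun c f => NNReal.eq (hsmul c f) }
  have hΛ : ∀ f, (Λ f : ℝ) = T f := fun f => rfl
  refine ⟨NNRealRMK.rieszMeasure Λ, ⟨?_⟩, fun f => by simp [hΛ]⟩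
  -- By inner regularity only compact sets have to be bounded, and each of them is dominated by a
  -- cutoff with values in `[0, 1]`.
  rw [isOpen_univ.measure_eq_iSup_isCompact]
  refine lt_of_le_of_lt (b := ENNReal.ofReal C) ?_ ENNReal.ofReal_lt_top
  refine iSup₂_le fun K _ => iSup_le fun hK => ?_
  obtain ⟨f, hf1, -, hfc, hf01⟩ := exists_continuous_one_zero_of_isCompact hK isClosed_empty
    (Set.disjoint_empty K)
  let g : C_c(X, ℝ≥0) := CompactlySupportedContinuousMap.nnrealPart ⟨f, hfc⟩
  have hg : ∀ x, g x = Real.toNNReal (f x) := fun x => rfl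
  have h1 : ∫⁻ x, g x ∂(NNRealRMK.rieszMeasure Λ) = Λ g := NNRealRMK.lintegral_rieszMeasure Λ g
  have h2 : (Λ g : ENNReal) ≤ ENNReal.ofReal C := by
    rw [← ENNReal.ofReal_coe_nnreal, hΛ]
    refine ENNReal.ofReal_le_ofReal (hC g fun x => ?_)
    rw [hg]
    simpa using (hf01 x).2
  refine le_trans ?_ (h1 ▸ h2)
  calc NNRealRMK.rieszMeasure Λ K = ∫⁻ x in K, 1 ∂(NNRealRMK.rieszMeasure Λ) := by simp
    _ ≤ ∫⁻ x in K, g x ∂(NNRealRMK.rieszMeasure Λ) := by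
        refine setLIntegral_mono' hK.measurableSet fun x hx => ?_
        rw [hg, hf1 hx]; simp
    _ ≤ _ := setLIntegral_le_lintegral _ _

/-- A bounded functional on the space of bounded continuous functions acts on the continuous
functions with compact support as the difference of two finite measures. -/
theorem exists_signed_representation (L : StrongDual ℝ (BoundedContinuousFunction X ℝ)) :
    ∃ μ ν : Measure X, IsFiniteMeasure μ ∧ IsFiniteMeasure ν ∧
      ∀ f : BoundedContinuousFunction X ℝ, HasCompactSupport f →
        L f = ∫ x, f x ∂μ - ∫ x, f x ∂ν := by
  let ℓ : C_c(X, ℝ≥0) → ℝ := fun f => L f.toReal.toBoundedContinuousFunction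
  have hadd : ∀ f g, ℓ (f + g) = ℓ f + ℓ g := by
    intro f g
    simp only [ℓ]
    rw [← map_add]
    congr 1
    ext x; simp
  have hsmul : ∀ (c : ℝ≥0) f, ℓ (c • f) = c * ℓ f := by
    intro c f
    simp only [ℓ]
    rw [← smul_eq_mul, ← map_smul]
    congr 1
    ext x; simp [NNReal.smul_def]
  have hC : ∀ f, (∀ x, f x ≤ 1) → |ℓ f| ≤ ‖L‖ := by
    intro f hf
    refine (L.le_opNorm _).trans ?_
    refine mul_le_of_le_one_right (norm_nonneg _) ?_
    rw [BoundedContinuousFunction.norm_le zero_le_one]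
    intro x
    simpa using hf x
  obtain ⟨P, Padd, Psmul, Ppos, Ple, PC⟩ := exists_positive_part_functional ℓ ‖L‖ hadd hsmul hC
  obtain ⟨μ, hμ, hμP⟩ := exists_finite_measure_of_bounded_positive P _ Padd Psmul Ppos PC
  -- Jordan decomposition `ℓ = P - (P - ℓ)`; the second part is positive because `ℓ ≤ P`.
  obtain ⟨ν, hν, hνP⟩ := exists_finite_measure_of_bounded_positive (fun f => P f - ℓ f)
    (‖L‖ + ‖L‖) (fun f g => by rw [Padd, hadd]; ring) (fun c f => by rw [Psmul, hsmul]; ring)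
    (fun f => sub_nonneg.2 (Ple f))
    (fun f hf => by have := PC f hf; have := neg_le_of_abs_le (hC f hf); linarith)
  refine ⟨μ, ν, hμ, hν, fun f hf => ?_⟩
  have key : ∀ g : C_c(X, ℝ≥0), ℓ g = ∫ x, (g x : ℝ) ∂μ - ∫ x, (g x : ℝ) ∂ν := by
    intro g; rw [hμP, hνP]; ring
  let f' : C_c(X, ℝ) := ⟨⟨f, f.continuous⟩, hf⟩
  have e : L f = ℓ f'.nnrealPart - ℓ (-f').nnrealPart := by
    simp only [ℓ]
    rw [← map_sub]
    congr 1
    ext x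
    simp only [BoundedContinuousFunction.coe_sub, Pi.sub_apply,
      CompactlySupportedContinuousMap.toBoundedContinuousFunction_apply,
      CompactlySupportedContinuousMap.toReal_apply,
      CompactlySupportedContinuousMap.nnrealPart_apply, Real.coe_toNNReal',
      CompactlySupportedContinuousMap.coe_neg, Pi.neg_apply]
    change f x = max (f x) 0 - max (- f x) 0
    rcases le_total (f x) 0 with h | h <;> simp [h]
  have hi : ∀ (ρ : Measure X) [IsFiniteMeasure ρ],
      ∫ x, f x ∂ρ = ∫ x, (f'.nnrealPart x : ℝ) ∂ρ - ∫ x, ((-f').nnrealPart x : ℝ) ∂ρ := by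
    intro ρ _
    exact integral_eq_integral_pos_part_sub_integral_neg_part (f.integrable ρ)
  rw [e, key, key, hi μ, hi ν]
  ring

end SignedRiesz

/-! ### Calculus of the divergence. -/

section Divergence

theorem isOpen_halfSpace : IsOpen halfSpace :=
  isOpen_lt continuous_const (by fun_prop)

theorem divergence_smul {g : E3 → ℝ} {φ : E3 → E3} {x : E3} (hg : DifferentiableAt ℝ g x)
    (hφ : DifferentiableAt ℝ φ x) :
    divergence (fun y => g y • φ y) x = g x * divergence φ x + fderiv ℝ g x (φ x) := by
  have h : fderiv ℝ (fun y => g y • φ y) x = g x • fderiv ℝ φ x + (fderiv ℝ g x).smulRight (φ x) :=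
    fderiv_fun_smul hg hφ
  simp only [divergence, h, add_apply, smul_apply,
    ContinuousLinearMap.smulRight_apply, PiLp.add_apply, PiLp.smul_apply, smul_eq_mul,
    Finset.sum_add_distrib, Finset.mul_sum]
  congr 1
  have : φ x = ∑ i, φ x i • EuclideanSpace.single i (1 : ℝ) := by
    ext j
    simp [Fin.sum_univ_three]
    fin_cases j <;> simp
  conv_rhs => rw [this]
  rw [map_sum]
  refine Finset.sum_congr rfl fun i _ => ?_
  rw [map_smul, smul_eq_mul, mul_comm]

theorem divergence_add {φ ψ : E3 → E3} {x : E3} (hφ : DifferentiableAt ℝ φ x)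
    (hψ : DifferentiableAt ℝ ψ x) :
    divergence (fun y => φ y + ψ y) x = divergence φ x + divergence ψ x := by
  simp [divergence, fderiv_fun_add hφ hψ, Finset.sum_add_distrib]

theorem divergence_sub {φ ψ : E3 → E3} {x : E3} (hφ : DifferentiableAt ℝ φ x)
    (hψ : DifferentiableAt ℝ ψ x) :
    divergence (fun y => φ y - ψ y) x = divergence φ x - divergence ψ x := by
  simp [divergence, fderiv_fun_sub hφ hψ, Finset.sum_sub_distrib]

theorem divergence_neg (φ : E3 → E3) (x : E3) :
    divergence (fun y => -φ y) x = -divergence φ x := by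
  simp [divergence, fderiv_fun_neg]

theorem divergence_comp_add_right (φ : E3 → E3) (x y : E3) :
    divergence (fun z => φ (z + y)) x = divergence φ (x + y) := by
  simp [divergence, fderiv_comp_add_right]

/-- The divergence of a field pointing in the fixed direction `v`. -/
theorem divergence_smul_const {g : E3 → ℝ} (v x : E3) (hg : DifferentiableAt ℝ g x) :
    divergence (fun y => g y • v) x = fderiv ℝ g x v := by
  rw [divergence_smul hg (differentiableAt_const v)]
  simp [divergence]

theorem divergence_eq_sum_fderiv {φ : E3 → E3} {x : E3} (hφ : DifferentiableAt ℝ φ x) :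
    divergence φ x = ∑ i : Fin 3, fderiv ℝ (fun y => φ y i) x (EuclideanSpace.single i 1) := by
  refine Finset.sum_congr rfl fun i _ => ?_
  have h := (((EuclideanSpace.proj i : E3 →L[ℝ] ℝ).hasFDerivAt (x := φ x)).comp x
    hφ.hasFDerivAt).fderiv
  have h' : (⇑(EuclideanSpace.proj i : E3 →L[ℝ] ℝ) ∘ φ) = fun y => φ y i := by ext; simp
  rw [h'] at h
  rw [h]
  simp

theorem continuous_divergence {φ : E3 → E3} (hφ : ContDiff ℝ 1 φ) :
    Continuous (divergence φ) := by
  have := hφ.continuous_fderiv one_ne_zero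
  unfold divergence
  fun_prop

theorem hasCompactSupport_divergence {φ : E3 → E3} (hφ : HasCompactSupport φ) :
    HasCompactSupport (divergence φ) := by
  refine (hφ.fderiv ℝ).mono' ?_
  refine fun x hx => subset_tsupport _ fun h => hx ?_
  simp [divergence, h]

theorem IsTestField.integrable_divergence {U : Set E3} {φ : E3 → E3} (h : IsTestField U φ) :
    Integrable (divergence φ) :=
  (continuous_divergence h.1).integrable_of_hasCompactSupport (hasCompactSupport_divergence h.2.1)

theorem integral_fderiv_apply_eq_zero {g : E3 → ℝ} (hg : ContDiff ℝ 1 g)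
    (hc : HasCompactSupport g) (v : E3) : ∫ x, fderiv ℝ g x v = 0 := by
  have hi : Integrable fun x => fderiv ℝ g x v :=
    (by have := hg.continuous_fderiv one_ne_zero
        fun_prop : Continuous fun x => fderiv ℝ g x v).integrable_of_hasCompactSupport
      ((hc.fderiv ℝ).comp_left (g := fun L : E3 →L[ℝ] ℝ => L v) rfl)
  have := integral_mul_fderiv_eq_neg_fderiv_mul_of_integrable (μ := volume) (f := fun _ : E3 => (1:ℝ))
    (g := g) (v := v) (by simp) (by simpa using hi)
    (by simpa using hg.continuous.integrable_of_hasCompactSupport hc)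
    (fun x _ => differentiableAt_const _) (fun x _ => hg.differentiable one_ne_zero x)
  simpa using this

theorem IsTestField.integral_divergence {U : Set E3} {φ : E3 → E3} (h : IsTestField U φ) :
    ∫ x, divergence φ x = 0 := by
  have hd := h.1.differentiable one_ne_zero
  have hs : ∀ i : Fin 3, ContDiff ℝ 1 fun y => φ y i := fun i => by
    have := h.1
    fun_prop
  have hc : ∀ i : Fin 3, HasCompactSupport fun y => φ y i := fun i =>
    h.2.1.comp_left (g := fun v : E3 => v i) rfl
  simp_rw [fun x => divergence_eq_sum_fderiv (hd x)]
  rw [integral_finsetSum]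
  · exact Finset.sum_eq_zero fun i _ => integral_fderiv_apply_eq_zero (hs i) (hc i) _
  · intro i _
    have := (hs i).continuous_fderiv one_ne_zero
    exact (by fun_prop : Continuous fun x => fderiv ℝ (fun y => φ y i) x
      (EuclideanSpace.single i 1)).integrable_of_hasCompactSupport
      (((hc i).fderiv ℝ).comp_left (g := fun L : E3 →L[ℝ] ℝ => L (EuclideanSpace.single i 1)) rfl)

end Divergence

/-! ### Elementary properties of the perimeter. -/

section Perimeter

theorem perimeter_congr_ae {A B : Set E3} (h : A =ᵐ[volume] B) (U : Set E3) :
    perimeter A U = perimeter B U := by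
  unfold perimeter
  simp_rw [setIntegral_congr_set h]

theorem IsTestField.neg {U : Set E3} {φ : E3 → E3} (h : IsTestField U φ) :
    IsTestField U (fun x => -φ x) :=
  ⟨h.1.neg, by simpa [HasCompactSupport, tsupport, Function.support_fun_neg] using h.2.1,
    by simpa [tsupport, Function.support_fun_neg] using h.2.2⟩

/-- The divergence of a test field has total integral zero, so testing `Aᶜ` with `φ` is testing `A`
with `-φ`. This is what turns submodularity into its version for differences. -/
theorem perimeter_compl_le {A : Set E3} (hA : MeasurableSet A) (U : Set E3) :
    perimeter Aᶜ U ≤ perimeter A U := by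
  refine iSup₂_le fun φ hφ => ?_
  have h := setIntegral_compl (μ := volume) hA hφ.1.integrable_divergence
  rw [hφ.1.integral_divergence, zero_sub] at h
  rw [h, ← integral_neg]
  simp_rw [← divergence_neg]
  exact le_iSup₂_of_le (fun x => -φ x) ⟨hφ.1.neg, by simpa using hφ.2⟩ le_rfl

theorem perimeter_compl {A : Set E3} (hA : MeasurableSet A) (U : Set E3) :
    perimeter Aᶜ U = perimeter A U :=
  le_antisymm (perimeter_compl_le hA U) (by simpa using perimeter_compl_le hA.compl U)

theorem integral_divergence_le_perimeter {A U : Set E3} (hA : perimeter A U ≠ ⊤) {φ : E3 → E3}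
    (hφ : IsTestField U φ) (h1 : ∀ x, ‖φ x‖ ≤ 1) :
    ∫ x in A, divergence φ x ≤ (perimeter A U).toReal := by
  rw [← ENNReal.ofReal_le_iff_le_toReal hA]
  exact le_iSup₂_of_le φ ⟨hφ, h1⟩ le_rfl

theorem integral_divergence_le_mul_perimeter {A U : Set E3} (hA : perimeter A U ≠ ⊤)
    {φ : E3 → E3} (hφ : IsTestField U φ) {K : ℝ} (hK : ∀ x, ‖φ x‖ ≤ K) :
    ∫ x in A, divergence φ x ≤ K * (perimeter A U).toReal := by
  have hK0 : 0 ≤ K := (norm_nonneg _).trans (hK 0)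
  rcases hK0.eq_or_lt with rfl | hK0
  · have : φ = fun _ => 0 := by
      ext1 x
      simpa using hK x
    simp [this, divergence]
  · have hd := hφ.1.differentiable one_ne_zero
    have hs : ∀ x, divergence (fun y => K⁻¹ • φ y) x = K⁻¹ * divergence φ x := fun x => by
      rw [divergence_smul (g := fun _ => K⁻¹) (differentiableAt_const _) (hd x)]
      simp
    have := integral_divergence_le_perimeter hA (φ := fun y => K⁻¹ • φ y)
      ⟨hφ.1.const_smul K⁻¹, hφ.2.1.smul_left (f := fun _ => K⁻¹),
        (tsupport_smul_subset_right (fun _ => K⁻¹) φ).trans hφ.2.2⟩ (fun x => by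
          rw [norm_smul, norm_inv, Real.norm_of_nonneg hK0.le, inv_mul_le_iff₀ hK0]
          simpa using hK x)
    simp_rw [hs] at this
    rwa [integral_const_mul, inv_mul_le_iff₀ hK0] at this

theorem IsTestField.comp_add_right {K U : Set E3} {φ : E3 → E3} (h : IsTestField K φ) {y : E3}
    (hy : ∀ x ∈ K, x - y ∈ U) : IsTestField U (fun x => φ (x + y)) := by
  have e : tsupport (fun x => φ (x + y)) = (Homeomorph.addRight y) ⁻¹' tsupport φ :=
    tsupport_comp_eq_preimage φ (Homeomorph.addRight y)
  refine ⟨h.1.comp (contDiff_id.add contDiff_const),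
    h.2.1.comp_homeomorph (Homeomorph.addRight y), ?_⟩
  rw [e]
  intro x hx
  simpa using hy _ (h.2.2 hx)

end Perimeter

/-! ### Submodularity of the perimeter, by mollification. -/

section Submodularity

/-- The mollification of the characteristic function of `A`. -/
def mollify (ρ : ContDiffBump (0 : E3)) (A : Set E3) (x : E3) : ℝ :=
  ∫ y, ρ.normed volume y * A.indicator 1 (x - y)

theorem mollify_eq_convolution (ρ : ContDiffBump (0 : E3)) (A : Set E3) :
    mollify ρ A = convolution (ρ.normed volume) (A.indicator 1)
      (ContinuousLinearMap.lsmul ℝ ℝ) volume := by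
  ext x; simp [mollify, convolution]

theorem measurable_indicator_one {A : Set E3} (hA : MeasurableSet A) :
    Measurable (A.indicator (1 : E3 → ℝ)) := measurable_one.indicator hA

theorem norm_indicator_one_le (A : Set E3) (x : E3) : ‖A.indicator (1 : E3 → ℝ) x‖ ≤ 1 := by
  by_cases h : x ∈ A <;> simp [h]

theorem locallyIntegrable_indicator_one {A : Set E3} (hA : MeasurableSet A) :
    LocallyIntegrable (A.indicator (1 : E3 → ℝ)) :=
  (locallyIntegrable_const (1 : ℝ)).indicator hA

theorem contDiff_mollify (ρ : ContDiffBump (0 : E3)) {A : Set E3} (hA : MeasurableSet A) :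
    ContDiff ℝ 1 (mollify ρ A) := by
  rw [mollify_eq_convolution]
  exact ρ.hasCompactSupport_normed.contDiff_convolution_left (n := 1) _ ρ.contDiff_normed
    (locallyIntegrable_indicator_one hA)

theorem abs_mollify_le (ρ : ContDiffBump (0 : E3)) (A : Set E3) (x : E3) :
    |mollify ρ A x| ≤ 1 := by
  rw [← Real.norm_eq_abs, ← ρ.integral_normed (μ := volume)]
  refine norm_integral_le_of_norm_le ρ.integrable_normed (Eventually.of_forall fun y => ?_)
  rw [norm_mul, Real.norm_of_nonneg (ρ.nonneg_normed y)]
  exact mul_le_of_le_one_right (ρ.nonneg_normed y) (norm_indicator_one_le A _)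

/-- Testing the mollification of `A` with a divergence averages tests of `A` with translates. -/
theorem integral_mollify_mul_divergence_le (ρ : ContDiffBump (0 : E3)) {A : Set E3}
    (hA : MeasurableSet A) {K U : Set E3} (hP : perimeter A U ≠ ⊤)
    (hK : ∀ x ∈ K, ∀ y ∈ Metric.ball (0 : E3) ρ.rOut, x - y ∈ U) {φ : E3 → E3}
    (hφ : IsTestField K φ) (h1 : ∀ x, ‖φ x‖ ≤ 1) :
    ∫ x, mollify ρ A x * divergence φ x ≤ (perimeter A U).toReal := by
  have hint : Integrable (fun p : E3 × E3 =>
      (ρ.normed volume p.2 * A.indicator 1 (p.1 - p.2)) * divergence φ p.1)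
      (volume.prod volume) := by
    have h := (hφ.integrable_divergence.mul_prod (ρ.integrable_normed (μ := volume)))
    have h2 := h.bdd_mul (c := 1) (f := fun p : E3 × E3 => A.indicator (1 : E3 → ℝ) (p.1 - p.2))
      (((measurable_indicator_one hA).comp
        (measurable_fst.sub measurable_snd)).aestronglyMeasurable)
      (Eventually.of_forall fun p => norm_indicator_one_le A _)
    refine h2.congr (Eventually.of_forall fun p => ?_)
    simp only
    ring
  have e1 : ∫ x, mollify ρ A x * divergence φ x =
      ∫ x, ∫ y, (ρ.normed volume y * A.indicator 1 (x - y)) * divergence φ x := by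
    refine integral_congr_ae (Eventually.of_forall fun x => ?_)
    simp only [mollify]
    rw [integral_mul_const]
  rw [e1, integral_integral_swap hint, ← mul_one (perimeter A U).toReal,
    ← ρ.integral_normed (μ := volume), ← integral_const_mul]
  refine integral_mono hint.integral_prod_right
    (ρ.integrable_normed.const_mul _) fun y => ?_
  simp only
  by_cases hy : y ∈ Metric.ball (0 : E3) ρ.rOut
  · have e2 : ∫ x, (ρ.normed volume y * A.indicator 1 (x - y)) * divergence φ x =
        ρ.normed volume y * ∫ x in A, divergence (fun z => φ (z + y)) x := by
      simp_rw [mul_assoc]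
      rw [integral_const_mul, ← integral_indicator hA,
        ← integral_sub_right_eq_self (A.indicator fun x => divergence (fun z => φ (z + y)) x) y]
      congr 1
      refine integral_congr_ae (Eventually.of_forall fun x => ?_)
      simp only [divergence_comp_add_right]
      by_cases hx : x - y ∈ A <;> simp [hx]
    rw [e2, mul_comm]
    exact mul_le_mul_of_nonneg_right (integral_divergence_le_perimeter hP
      (hφ.comp_add_right fun x hx => hK x hx y hy) fun x => h1 _) (ρ.nonneg_normed y)
  · have : ρ.normed volume y = 0 := by
      rw [← Function.notMem_support, ρ.support_normed_eq]; exact hy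
    simp [this]

/-- The smoothing `(s + √(s² + δ²)) / 2` of the positive part. -/
def smoothPos (δ s : ℝ) : ℝ := (s + √(s ^ 2 + δ ^ 2)) / 2

/-- The derivative of `smoothPos δ`. -/
def smoothStep (δ s : ℝ) : ℝ := (1 + s / √(s ^ 2 + δ ^ 2)) / 2

variable {δ : ℝ}

theorem hasDerivAt_smoothPos (hδ : 0 < δ) (s : ℝ) :
    HasDerivAt (smoothPos δ) (smoothStep δ s) s := by
  have h0 : s ^ 2 + δ ^ 2 ≠ 0 := by positivity
  have h := (((hasDerivAt_id s).pow 2).add_const (δ ^ 2)).sqrt (by simpa using h0)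
  have := ((hasDerivAt_id s).add h).div_const 2
  refine this.congr_deriv ?_
  have h1 : √(s ^ 2 + δ ^ 2) ≠ 0 := by positivity
  simp [smoothStep]
  field_simp

theorem contDiff_smoothStep (hδ : 0 < δ) : ContDiff ℝ 1 (smoothStep δ) := by
  unfold smoothStep
  have h0 : ∀ s : ℝ, s ^ 2 + δ ^ 2 ≠ 0 := fun s => by positivity
  have : ContDiff ℝ 1 fun s : ℝ => √(s ^ 2 + δ ^ 2) :=
    ((contDiff_id.pow 2).add contDiff_const).sqrt h0
  exact (contDiff_const.add (contDiff_id.div this fun s => by positivity)).div_const 2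

theorem smoothStep_mem_Icc (hδ : 0 < δ) (s : ℝ) : smoothStep δ s ∈ Set.Icc (0 : ℝ) 1 := by
  have hp : 0 < √(s ^ 2 + δ ^ 2) := by positivity
  have h : |s / √(s ^ 2 + δ ^ 2)| ≤ 1 := by
    rw [abs_div, abs_of_pos hp, div_le_one hp]
    exact Real.abs_le_sqrt (by nlinarith)
  have := abs_le.1 h
  constructor <;> unfold smoothStep <;> linarith [this.1, this.2]

theorem abs_smoothPos_sub_max_le (hδ : 0 < δ) (s : ℝ) : |smoothPos δ s - max s 0| ≤ δ := by
  have h1 : |s| ≤ √(s ^ 2 + δ ^ 2) := Real.abs_le_sqrt (by nlinarith)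
  have h2 : √(s ^ 2 + δ ^ 2) ≤ |s| + δ := by
    rw [Real.sqrt_le_left (by positivity)]
    nlinarith [abs_nonneg s, sq_abs s]
  have h3 : max s 0 = (s + |s|) / 2 := by
    rcases le_total s 0 with h | h
    · rw [max_eq_right h, abs_of_nonpos h]; ring
    · rw [max_eq_left h, abs_of_nonneg h]; ring
  rw [h3, smoothPos, abs_le]
  constructor <;> linarith

theorem HasCompactSupport.union_tsupport {φ ψ : E3 → E3} (hφ : HasCompactSupport φ)
    (hψ : HasCompactSupport ψ) : IsCompact (tsupport φ ∪ tsupport ψ) :=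
  IsCompact.union hφ hψ

theorem isTestField_of_subset {K : Set E3} (hK : IsCompact K) {φ : E3 → E3}
    (hφ : ContDiff ℝ 1 φ) (h : ∀ x, x ∉ K → φ x = 0) : IsTestField K φ := by
  have hs : tsupport φ ⊆ K :=
    closure_minimal (fun x hx => by by_contra h'; exact hx (h x h')) hK.isClosed
  exact ⟨hφ, HasCompactSupport.of_support_subset_isCompact hK
    ((subset_tsupport φ).trans hs), hs⟩

/-- Exchanging the fields according to the sign of `u - v`. -/
theorem integral_switched_fields {u v : E3 → ℝ} (hu : ContDiff ℝ 1 u) (hv : ContDiff ℝ 1 v)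
    {φ₁ φ₂ : E3 → E3} {U : Set E3} (h₁ : IsTestField U φ₁) (h₂ : IsTestField U φ₂)
    (hδ : 0 < δ) :
    ∫ x, (u x * divergence (fun y => φ₂ y + smoothStep δ (u y - v y) • (φ₁ y - φ₂ y)) x +
        v x * divergence (fun y => φ₁ y - smoothStep δ (u y - v y) • (φ₁ y - φ₂ y)) x) =
      ∫ x, ((v x + smoothPos δ (u x - v x)) * divergence φ₁ x +
        (u x - smoothPos δ (u x - v x)) * divergence φ₂ x) := by
  have hw : ContDiff ℝ 1 fun y => u y - v y := hu.sub hv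
  have ha : ContDiff ℝ 1 fun y => smoothStep δ (u y - v y) := (contDiff_smoothStep hδ).comp hw
  have hpos : ContDiff ℝ 1 (smoothPos δ) := by
    unfold smoothPos
    exact (contDiff_id.add (((contDiff_id.pow 2).add contDiff_const).sqrt
      fun s => by positivity)).div_const 2
  have hb : ContDiff ℝ 1 fun y => smoothPos δ (u y - v y) := hpos.comp hw
  -- With `w = u - v`, the gradient of `g` is `w ∇(smoothStep δ w)`, since `smoothStep δ` is the
  -- derivative of `smoothPos δ`. The two integrands then differ by exactly the divergence of `g •
  -- (φ₁ - φ₂)`.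
  let g : E3 → ℝ := fun y => (u y - v y) * smoothStep δ (u y - v y) - smoothPos δ (u y - v y)
  have hg : ContDiff ℝ 1 g := (hw.mul ha).sub hb
  have hθ : ContDiff ℝ 1 fun y => φ₁ y - φ₂ y := h₁.1.sub h₂.1
  have hK : IsCompact (tsupport φ₁ ∪ tsupport φ₂) := HasCompactSupport.union_tsupport h₁.2.1 h₂.2.1
  have hz₁ : ∀ x, x ∉ tsupport φ₁ ∪ tsupport φ₂ → φ₁ x = 0 := fun x hx =>
    image_eq_zero_of_notMem_tsupport fun h => hx (Or.inl h)
  have hz₂ : ∀ x, x ∉ tsupport φ₁ ∪ tsupport φ₂ → φ₂ x = 0 := fun x hx =>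
    image_eq_zero_of_notMem_tsupport fun h => hx (Or.inr h)
  have hgθ : IsTestField (tsupport φ₁ ∪ tsupport φ₂) fun y => g y • (φ₁ y - φ₂ y) :=
    isTestField_of_subset hK (hg.smul hθ) fun x hx => by simp [hz₁ x hx, hz₂ x hx]
  rw [← sub_eq_zero, ← integral_sub, ← hgθ.integral_divergence]
  · refine integral_congr_ae (Eventually.of_forall fun x => ?_)
    have dw := (hw.differentiable one_ne_zero) x
    have da := (ha.differentiable one_ne_zero) x
    have dθ := (hθ.differentiable one_ne_zero) x
    have d1 := (h₁.1.differentiable one_ne_zero) x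
    have d2 := (h₂.1.differentiable one_ne_zero) x
    have dg := (hg.differentiable one_ne_zero) x
    have daθ : DifferentiableAt ℝ (fun y => smoothStep δ (u y - v y) • (φ₁ y - φ₂ y)) x :=
      da.smul dθ
    have fb : HasFDerivAt (fun y => smoothPos δ (u y - v y))
        (smoothStep δ (u x - v x) • fderiv ℝ (fun y => u y - v y) x) x :=
      HasDerivAt.comp_hasFDerivAt (f := fun y => u y - v y) x
        (hasDerivAt_smoothPos hδ (u x - v x)) dw.hasFDerivAt
    have fg : fderiv ℝ g x = (u x - v x) • fderiv ℝ (fun y => smoothStep δ (u y - v y)) x := by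
      have := ((dw.hasFDerivAt.mul da.hasFDerivAt).sub fb).fderiv
      refine this.trans ?_
      simp
    simp only
    rw [divergence_smul dg dθ, divergence_add d2 daθ, divergence_sub d1 daθ,
      divergence_smul da dθ, divergence_sub d1 d2, fg]
    simp only [smul_apply, smul_eq_mul, g]
    ring
  · have hi : ∀ {f : E3 → ℝ} {φ : E3 → E3}, Continuous f → ContDiff ℝ 1 φ →
        (∀ x, x ∉ tsupport φ₁ ∪ tsupport φ₂ → φ x = 0) →
        Integrable fun x => f x * divergence φ x := by
      intro f φ hf hφ h
      have ht := isTestField_of_subset hK hφ h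
      exact (hf.mul (continuous_divergence hφ)).integrable_of_hasCompactSupport
        ((hasCompactSupport_divergence ht.2.1).mul_left)
    exact (hi hu.continuous (h₂.1.add (ha.smul hθ))
      fun x hx => by simp [hz₁ x hx, hz₂ x hx]).add
      (hi hv.continuous (h₁.1.sub (ha.smul hθ)) fun x hx => by simp [hz₁ x hx, hz₂ x hx])
  · have hi : ∀ {f : E3 → ℝ} {φ : E3 → E3}, Continuous f → IsTestField U φ →
        Integrable fun x => f x * divergence φ x := by
      intro f φ hf hφ
      exact (hf.mul (continuous_divergence hφ.1)).integrable_of_hasCompactSupport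
        ((hasCompactSupport_divergence hφ.2.1).mul_left)
    exact (hi (hv.continuous.add hb.continuous) h₁).add (hi (hu.continuous.sub hb.continuous) h₂)

theorem exists_bump_sequence : ∃ ρ : ℕ → ContDiffBump (0 : E3),
    Tendsto (fun n => (ρ n).rOut) atTop (𝓝 0) ∧ ∀ n, (ρ n).rOut ≤ 2 * (ρ n).rIn := by
  refine ⟨fun n => ⟨1 / ((n : ℝ) + 1), 2 * (1 / ((n : ℝ) + 1)), by positivity, ?_⟩, ?_,
    fun n => le_rfl⟩
  · have : 0 < 1 / ((n : ℝ) + 1) := by positivity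
    linarith
  · simpa using (tendsto_one_div_add_atTop_nhds_zero_nat (𝕜 := ℝ)).const_mul 2

/-- For mollifications `u`, `v` of the two sets, `max u v = v + (u - v)⁺` and `min u v = u - (u -
v)⁺` approximate the union and the intersection. Testing them with `φ₁`, `φ₂` amounts to testing `u`
and `v` with convex combinations of `φ₁` and `φ₂`, which keep the bound one. The positive part is
smoothed so that these combinations are of class `C¹`. -/
theorem integral_union_add_integral_inter_le {A B U : Set E3} (hA : MeasurableSet A)
    (hB : MeasurableSet B) (hU : IsOpen U) (hPA : perimeter A U ≠ ⊤) (hPB : perimeter B U ≠ ⊤)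
    {φ₁ φ₂ : E3 → E3} (h₁ : IsTestField U φ₁) (h₂ : IsTestField U φ₂)
    (n₁ : ∀ x, ‖φ₁ x‖ ≤ 1) (n₂ : ∀ x, ‖φ₂ x‖ ≤ 1) :
    (∫ x in A ∪ B, divergence φ₁ x) + ∫ x in A ∩ B, divergence φ₂ x ≤
      (perimeter A U).toReal + (perimeter B U).toReal := by
  obtain ⟨ρ, hρ0, hρ2⟩ := exists_bump_sequence
  have hK : IsCompact (tsupport φ₁ ∪ tsupport φ₂) := HasCompactSupport.union_tsupport h₁.2.1 h₂.2.1
  -- This margin keeps the translated fields inside `U` once the mollification radius is below `ε`.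
  obtain ⟨ε, hε, hεU⟩ := hK.exists_thickening_subset_open hU (Set.union_subset h₁.2.2 h₂.2.2)
  have hz₁ : ∀ x, x ∉ tsupport φ₁ ∪ tsupport φ₂ → φ₁ x = 0 := fun x hx =>
    image_eq_zero_of_notMem_tsupport fun h => hx (Or.inl h)
  have hz₂ : ∀ x, x ∉ tsupport φ₁ ∪ tsupport φ₂ → φ₂ x = 0 := fun x hx =>
    image_eq_zero_of_notMem_tsupport fun h => hx (Or.inr h)
  let u : ℕ → E3 → ℝ := fun n => mollify (ρ n) A
  let v : ℕ → E3 → ℝ := fun n => mollify (ρ n) B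
  let d : ℕ → ℝ := fun n => 1 / ((n : ℝ) + 1)
  have hd : ∀ n, 0 < d n := fun n => by positivity
  have hd1 : ∀ n, d n ≤ 1 := fun n => by
    rw [div_le_one (by positivity)]; linarith [(Nat.cast_nonneg n : (0 : ℝ) ≤ n)]
  have hd0 : Tendsto d atTop (𝓝 0) := tendsto_one_div_add_atTop_nhds_zero_nat
  have hu : ∀ n, ContDiff ℝ 1 (u n) := fun n => contDiff_mollify _ hA
  have hv : ∀ n, ContDiff ℝ 1 (v n) := fun n => contDiff_mollify _ hB
  have hub : ∀ n x, |u n x| ≤ 1 := fun n x => abs_mollify_le _ _ _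
  have hvb : ∀ n x, |v n x| ≤ 1 := fun n x => abs_mollify_le _ _ _
  let F : ℕ → E3 → ℝ := fun n x =>
    (v n x + smoothPos (d n) (u n x - v n x)) * divergence φ₁ x +
        (u n x - smoothPos (d n) (u n x - v n x)) * divergence φ₂ x
  have hpc : ∀ n, Continuous fun x => smoothPos (d n) (u n x - v n x) := fun n =>
    (continuous_iff_continuousAt.2 fun s =>
      (hasDerivAt_smoothPos (hd n) s).continuousAt).comp ((hu n).continuous.sub (hv n).continuous)
  have hlim : Tendsto (fun n => ∫ x, F n x) atTop
      (𝓝 (∫ x, ((A ∪ B).indicator (divergence φ₁) x + (A ∩ B).indicator (divergence φ₂) x))) := by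
    refine tendsto_integral_of_dominated_convergence
      (fun x => 4 * ‖divergence φ₁ x‖ + 4 * ‖divergence φ₂ x‖) ?_ ?_ ?_ ?_
    · intro n
      have h1 := (hu n).continuous
      have h2 := (hv n).continuous
      have h3 := hpc n
      have h4 := continuous_divergence h₁.1
      have h5 := continuous_divergence h₂.1
      exact (by fun_prop : Continuous (F n)).aestronglyMeasurable
    · exact (h₁.integrable_divergence.norm.const_mul 4).add
        (h₂.integrable_divergence.norm.const_mul 4)
    · intro n
      refine Eventually.of_forall fun x => ?_
      have e1 := abs_le.1 (abs_smoothPos_sub_max_le (hd n) (u n x - v n x))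
      have e2 := abs_le.1 (hub n x)
      have e3 := abs_le.1 (hvb n x)
      have e4 := hd1 n
      have e5 : max (u n x - v n x) 0 ≤ 2 := max_le (by linarith [e2.2, e3.1]) (by norm_num)
      have e6 : 0 ≤ max (u n x - v n x) 0 := le_max_right _ _
      refine (norm_add_le _ _).trans (add_le_add ?_ ?_)
      · rw [norm_mul]
        refine mul_le_mul_of_nonneg_right ?_ (norm_nonneg _)
        rw [Real.norm_eq_abs, abs_le]
        constructor <;> linarith [e1.1, e1.2, e2.1, e2.2, e3.1, e3.2]
      · rw [norm_mul]
        refine mul_le_mul_of_nonneg_right ?_ (norm_nonneg _)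
        rw [Real.norm_eq_abs, abs_le]
        constructor <;> linarith [e1.1, e1.2, e2.1, e2.2, e3.1, e3.2]
    · have ca := ContDiffBump.ae_convolution_tendsto_right_of_locallyIntegrable (μ := volume)
        hρ0 (Eventually.of_forall hρ2) (locallyIntegrable_indicator_one hA)
      have cb := ContDiffBump.ae_convolution_tendsto_right_of_locallyIntegrable (μ := volume)
        hρ0 (Eventually.of_forall hρ2) (locallyIntegrable_indicator_one hB)
      filter_upwards [ca, cb] with x hxa hxb
      simp_rw [← mollify_eq_convolution] at hxa hxb
      have hw := hxa.sub hxb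
      have hp : Tendsto (fun n => smoothPos (d n) (u n x - v n x)) atTop
          (𝓝 (max (A.indicator 1 x - B.indicator 1 x) 0)) := by
        have h1 : Tendsto (fun n => smoothPos (d n) (u n x - v n x) - max (u n x - v n x) 0)
            atTop (𝓝 0) :=
          squeeze_zero_norm (fun n => abs_smoothPos_sub_max_le (hd n) _) hd0
        have := h1.add (hw.max (tendsto_const_nhds (x := (0 : ℝ))))
        refine (this.congr fun n => ?_).trans (by rw [zero_add])
        exact sub_add_cancel _ _
      have := ((hxb.add hp).mul_const (divergence φ₁ x)).add
        ((hxa.sub hp).mul_const (divergence φ₂ x))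
      refine this.trans (le_of_eq (congrArg 𝓝 ?_))
      by_cases ha : x ∈ A <;> by_cases hb : x ∈ B <;> simp [ha, hb]
  have hle : ∀ᶠ n in atTop, ∫ x, F n x ≤ (perimeter A U).toReal + (perimeter B U).toReal := by
    filter_upwards [hρ0.eventually (gt_mem_nhds hε)] with n hn
    have hKn : ∀ x ∈ tsupport φ₁ ∪ tsupport φ₂, ∀ y ∈ Metric.ball (0 : E3) (ρ n).rOut,
        x - y ∈ U := by
      intro x hx y hy
      refine hεU (Metric.mem_thickening_iff.2 ⟨x, hx, ?_⟩)
      rw [dist_eq_norm, sub_sub_cancel_left, norm_neg]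
      exact (mem_ball_zero_iff.1 hy).trans hn
    have ha : ContDiff ℝ 1 fun y => smoothStep (d n) (u n y - v n y) :=
      (contDiff_smoothStep (hd n)).comp ((hu n).sub (hv n))
    have hθ : ContDiff ℝ 1 fun y => φ₁ y - φ₂ y := h₁.1.sub h₂.1
    have t₁ := isTestField_of_subset hK
      (φ := fun y => φ₂ y + smoothStep (d n) (u n y - v n y) • (φ₁ y - φ₂ y))
      (h₂.1.add (ha.smul hθ)) fun x hx => by simp [hz₁ x hx, hz₂ x hx]
    have t₂ := isTestField_of_subset hK
      (φ := fun y => φ₁ y - smoothStep (d n) (u n y - v n y) • (φ₁ y - φ₂ y))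
      (h₁.1.sub (ha.smul hθ)) fun x hx => by simp [hz₁ x hx, hz₂ x hx]
    have i₁ : Integrable fun x => u n x * divergence
        (fun y => φ₂ y + smoothStep (d n) (u n y - v n y) • (φ₁ y - φ₂ y)) x :=
      ((hu n).continuous.mul (continuous_divergence t₁.1)).integrable_of_hasCompactSupport
        ((hasCompactSupport_divergence t₁.2.1).mul_left)
    have i₂ : Integrable fun x => v n x * divergence
        (fun y => φ₁ y - smoothStep (d n) (u n y - v n y) • (φ₁ y - φ₂ y)) x :=
      ((hv n).continuous.mul (continuous_divergence t₂.1)).integrable_of_hasCompactSupport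
        ((hasCompactSupport_divergence t₂.2.1).mul_left)
    have hconv : ∀ (x : E3) (s : ℝ), s ∈ Set.Icc (0 : ℝ) 1 →
        ‖φ₂ x + s • (φ₁ x - φ₂ x)‖ ≤ 1 ∧ ‖φ₁ x - s • (φ₁ x - φ₂ x)‖ ≤ 1 := by
      intro x s hs
      have hc : Convex ℝ (Metric.closedBall (0 : E3) 1) := convex_closedBall 0 1
      have m₁ : φ₁ x ∈ Metric.closedBall (0 : E3) 1 := by simpa using n₁ x
      have m₂ : φ₂ x ∈ Metric.closedBall (0 : E3) 1 := by simpa using n₂ x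
      constructor
      · have := hc.add_smul_sub_mem m₂ m₁ hs
        simpa using this
      · have := hc.add_smul_sub_mem m₁ m₂ hs
        rw [← neg_sub (φ₁ x), smul_neg, ← sub_eq_add_neg] at this
        simpa using this
    have key := integral_switched_fields (hu n) (hv n) h₁ h₂ (hd n)
    rw [integral_add i₁ i₂] at key
    change ∫ x, ((v n x + smoothPos (d n) (u n x - v n x)) * divergence φ₁ x +
        (u n x - smoothPos (d n) (u n x - v n x)) * divergence φ₂ x) ≤ _
    rw [← key]
    exact add_le_add
      (integral_mollify_mul_divergence_le (ρ n) hA hPA hKn t₁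
        fun x => (hconv x _ (smoothStep_mem_Icc (hd n) _)).1)
      (integral_mollify_mul_divergence_le (ρ n) hB hPB hKn t₂
        fun x => (hconv x _ (smoothStep_mem_Icc (hd n) _)).2)
  have hfin := le_of_tendsto hlim hle
  rwa [integral_add (h₁.integrable_divergence.indicator (hA.union hB))
    (h₂.integrable_divergence.indicator (hA.inter hB)), integral_indicator (hA.union hB),
    integral_indicator (hA.inter hB)] at hfin

/-- The perimeter is submodular. -/
theorem perimeter_union_add_perimeter_inter_le {A B U : Set E3} (hA : MeasurableSet A)
    (hB : MeasurableSet B) (hU : IsOpen U) :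
    perimeter (A ∪ B) U + perimeter (A ∩ B) U ≤ perimeter A U + perimeter B U := by
  by_cases hPA : perimeter A U = ⊤
  · simp [hPA]
  by_cases hPB : perimeter B U = ⊤
  · simp [hPB]
  have hz : IsTestField U (fun _ => (0 : E3)) :=
    ⟨contDiff_const, HasCompactSupport.zero, by simp [tsupport, Function.support_fun_zero]⟩
  conv_lhs => unfold perimeter
  refine ENNReal.biSup_add_biSup_le' (p := fun φ => IsTestField U φ ∧ ∀ x, ‖φ x‖ ≤ 1)
    (q := fun φ => IsTestField U φ ∧ ∀ x, ‖φ x‖ ≤ 1)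
    ⟨_, hz, by simp⟩ ⟨_, hz, by simp⟩ fun φ₁ h₁ φ₂ h₂ => ?_
  have key : ∀ {ψ₁ ψ₂ : E3 → E3}, IsTestField U ψ₁ → IsTestField U ψ₂ →
      (∀ x, ‖ψ₁ x‖ ≤ 1) → (∀ x, ‖ψ₂ x‖ ≤ 1) → _ :=
    fun h₁ h₂ n₁ n₂ => integral_union_add_integral_inter_le hA hB hU hPA hPB h₁ h₂ n₁ n₂
  -- `ENNReal.ofReal` truncates negative integrals, so when one of the two is negative its field is
  -- replaced by zero.
  have k11 := key h₁.1 h₂.1 h₁.2 h₂.2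
  have k10 := key h₁.1 hz h₁.2 (by simp)
  have k01 := key hz h₂.1 (by simp) h₂.2
  have z : divergence (fun _ => (0 : E3)) = 0 := by ext; simp [divergence]
  simp only [z, Pi.zero_apply, integral_zero, add_zero, zero_add] at k10 k01
  rw [← ENNReal.ofReal_toReal hPA, ← ENNReal.ofReal_toReal hPB,
    ← ENNReal.ofReal_add ENNReal.toReal_nonneg ENNReal.toReal_nonneg]
  rcases le_total (∫ x in A ∪ B, divergence φ₁ x) 0 with h1 | h1
  · rw [ENNReal.ofReal_of_nonpos h1, zero_add]
    exact ENNReal.ofReal_le_ofReal k01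
  rcases le_total (∫ x in A ∩ B, divergence φ₂ x) 0 with h2 | h2
  · rw [ENNReal.ofReal_of_nonpos h2, add_zero]
    exact ENNReal.ofReal_le_ofReal k10
  rw [← ENNReal.ofReal_add h1 h2]
  exact ENNReal.ofReal_le_ofReal k11

end Submodularity

/-! ### The derivative of `χ_E` on the whole space is a measure. -/

section DistributionalDerivative

/-- A set of finite volume and finite perimeter in the half-space. -/
structure IsFinitePerimeterSet (E : Set E3) : Prop where
  measurableSet : MeasurableSet E
  subset : E ⊆ halfSpace
  volume_ne_top : volume E ≠ ⊤
  perimeter_ne_top : perimeter E halfSpace ≠ ⊤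

theorem IsBVSet.isFinitePerimeterSet {E : Set E3} (h : IsBVSet E) : IsFinitePerimeterSet E :=
  ⟨h.1, h.2, h.3.ne, h.4.ne⟩

theorem exists_bound_fderiv {w : E3 → ℝ} (hw : ContDiff ℝ 1 w) (hc : HasCompactSupport w) :
    ∃ C, ∀ x, ‖fderiv ℝ w x‖ ≤ C := by
  obtain ⟨C, hC⟩ := (hw.continuous_fderiv one_ne_zero).bounded_above_of_compact_support
    (hc.fderiv ℝ)
  exact ⟨C, hC⟩

/-- Cutoff functions with uniformly bounded derivatives. -/
theorem exists_cutoff : ∃ C : ℝ, 0 ≤ C ∧ ∀ K : Set E3, IsCompact K → ∃ u : E3 → ℝ,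
    ContDiff ℝ 1 u ∧ HasCompactSupport u ∧ (∀ x, 0 ≤ u x ∧ u x ≤ 1) ∧ (∀ x ∈ K, u x = 1) ∧
    ∀ x, ‖fderiv ℝ u x‖ ≤ C := by
  let b : ContDiffBump (0 : E3) := ⟨1, 2, one_pos, one_lt_two⟩
  have hb : ContDiff ℝ 1 b := b.contDiff
  obtain ⟨C, hC⟩ := exists_bound_fderiv hb b.hasCompactSupport
  have hC0 : 0 ≤ C := (norm_nonneg _).trans (hC 0)
  refine ⟨C, hC0, fun K hK => ?_⟩
  -- Stretching a fixed bump by `R > 1` only lowers its derivative, so the bound does not depend on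
  -- `K`.
  obtain ⟨R, hR, hKR⟩ := hK.isBounded.subset_closedBall_lt 1 (0 : E3)
  have hR0 : R ≠ 0 := by linarith
  refine ⟨fun x => b (R⁻¹ • x), hb.comp (contDiff_const_smul _), ?_, fun x => ⟨b.nonneg, b.le_one⟩,
    fun x hx => b.one_of_mem_closedBall ?_, fun x => ?_⟩
  · exact b.hasCompactSupport.comp_smul (inv_ne_zero hR0)
  · have := hKR hx
    rw [mem_closedBall_zero_iff] at this ⊢
    rw [norm_smul, norm_inv, Real.norm_of_nonneg (by linarith), inv_mul_le_iff₀ (by linarith)]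
    exact this.trans (mul_one R).ge
  · rw [fderiv_comp_smul, norm_smul, norm_inv, Real.norm_of_nonneg (by linarith)]
    calc R⁻¹ * ‖fderiv ℝ b (R⁻¹ • x)‖ ≤ 1 * C :=
          mul_le_mul (inv_le_one_of_one_le₀ hR.le) (hC _) (norm_nonneg _) zero_le_one
      _ = C := one_mul C

/-- The cutoff near the wall. -/
def wallCutoff (n : ℕ) (x : E3) : ℝ := Real.smoothTransition (n * x 2 - 1)

theorem contDiff_wallCutoff (n : ℕ) : ContDiff ℝ 1 (wallCutoff n) := by
  unfold wallCutoff
  exact Real.smoothTransition.contDiff.comp (by fun_prop)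

theorem wallCutoff_nonneg (n : ℕ) (x : E3) : 0 ≤ wallCutoff n x := Real.smoothTransition.nonneg _

theorem wallCutoff_le_one (n : ℕ) (x : E3) : wallCutoff n x ≤ 1 := Real.smoothTransition.le_one _

theorem tendsto_wallCutoff {x : E3} (hx : x ∈ halfSpace) :
    Tendsto (fun n => wallCutoff n x) atTop (𝓝 1) := by
  refine tendsto_const_nhds.congr' ?_
  obtain ⟨N, hN⟩ := exists_nat_gt (2 / x 2)
  have hx' : 0 < x 2 := hx
  filter_upwards [eventually_ge_atTop N] with n hn
  refine (Real.smoothTransition.one_of_one_le ?_).symm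
  rw [div_lt_iff₀ hx'] at hN
  have : (N : ℝ) * x 2 ≤ n * x 2 := by gcongr
  linarith

theorem wallCutoff_eq_zero {n : ℕ} {x : E3} (h : n * x 2 ≤ 1) : wallCutoff n x = 0 :=
  Real.smoothTransition.zero_of_nonpos (by linarith)

theorem fderiv_wallCutoff (n : ℕ) (x v : E3) :
    fderiv ℝ (wallCutoff n) x v = deriv Real.smoothTransition (n * x 2 - 1) * (n * v 2) := by
  have h1 : HasFDerivAt (fun y : E3 => (n : ℝ) * y 2 - 1)
      ((n : ℝ) • (EuclideanSpace.proj 2 : E3 →L[ℝ] ℝ)) x := by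
    have := ((EuclideanSpace.proj 2 : E3 →L[ℝ] ℝ).hasFDerivAt (x := x)).const_mul (n : ℝ)
    exact this.sub_const 1
  have h2 : HasDerivAt Real.smoothTransition (deriv Real.smoothTransition (n * x 2 - 1))
      (n * x 2 - 1) :=
    ((Real.smoothTransition.contDiff (n := 1)).differentiable one_ne_zero _).hasDerivAt
  have := (HasDerivAt.comp_hasFDerivAt (f := fun y : E3 => (n : ℝ) * y 2 - 1) x h2 h1).fderiv
  have e : (Real.smoothTransition ∘ fun y : E3 => (n : ℝ) * y 2 - 1) = wallCutoff n := rfl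
  rw [e] at this
  rw [this]
  simp

theorem norm_single_one (i : Fin 3) : ‖EuclideanSpace.single i (1 : ℝ)‖ = 1 := by simp

/-- The cutoff is a nondecreasing function of the height alone, so its gradient points upwards.
Boundary-layer terms in every direction are thus controlled by the vertical one. -/
theorem abs_fderiv_wallCutoff_le (n : ℕ) (x : E3) (i : Fin 3) :
    |fderiv ℝ (wallCutoff n) x (EuclideanSpace.single i 1)| ≤
      fderiv ℝ (wallCutoff n) x (EuclideanSpace.single 2 1) := by
  have h0 : 0 ≤ deriv Real.smoothTransition (n * x 2 - 1) := Real.smoothTransition.monotone.deriv_nonneg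
  have h1 : 0 ≤ deriv Real.smoothTransition (n * x 2 - 1) * n := by positivity
  rw [fderiv_wallCutoff, fderiv_wallCutoff]
  fin_cases i <;> simp [h1, abs_of_nonneg h1]

variable {E : Set E3}

theorem isTestField_wallCutoff_mul (n : ℕ) {g : E3 → ℝ} (hg : ContDiff ℝ 1 g)
    (hc : HasCompactSupport g) (v : E3) :
    IsTestField halfSpace fun x => (wallCutoff n x * g x) • v := by
  have hK : IsCompact (tsupport g ∩ {x : E3 | 1 ≤ n * x 2}) :=
    IsCompact.inter_right hc (isClosed_le continuous_const (by fun_prop))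
  have := isTestField_of_subset hK (φ := fun x => (wallCutoff n x * g x) • v)
    (((contDiff_wallCutoff n).mul hg).smul contDiff_const) fun x hx => by
      by_cases h : x ∈ tsupport g
      · have : (n : ℝ) * x 2 ≤ 1 := by
          by_contra h'
          exact hx ⟨h, (not_le.1 h').le⟩
        simp [wallCutoff_eq_zero this]
      · simp [image_eq_zero_of_notMem_tsupport h]
  refine ⟨this.1, this.2.1, this.2.2.trans fun x hx => ?_⟩
  have h1 : (1 : ℝ) ≤ n * x 2 := hx.2
  by_contra h
  have h2 : x 2 ≤ 0 := not_lt.1 h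
  have : (n : ℝ) * x 2 ≤ 0 := mul_nonpos_of_nonneg_of_nonpos (Nat.cast_nonneg n) h2
  linarith

theorem integrableOn_of_bounded {f : E3 → ℝ} (hE : volume E ≠ ⊤) (hf : Continuous f) {C : ℝ}
    (hC : ∀ x, |f x| ≤ C) : IntegrableOn f E :=
  Measure.integrableOn_of_bounded hE hf.aestronglyMeasurable (Eventually.of_forall hC)

theorem integrableOn_of_hasCompactSupport {f : E3 → ℝ} (hf : Continuous f)
    (hc : HasCompactSupport f) : IntegrableOn f E :=
  (hf.integrable_of_hasCompactSupport hc).integrableOn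

theorem continuous_fderiv_apply {g : E3 → ℝ} (hg : ContDiff ℝ 1 g) (v : E3) :
    Continuous fun x => fderiv ℝ g x v := by
  have := hg.continuous_fderiv one_ne_zero
  fun_prop

theorem hasCompactSupport_fderiv_apply {g : E3 → ℝ} (hc : HasCompactSupport g) (v : E3) :
    HasCompactSupport fun x => fderiv ℝ g x v :=
  (hc.fderiv ℝ).comp_left (g := fun L : E3 →L[ℝ] ℝ => L v) rfl

/-- Testing with `wallCutoff n * g`, expanded by the product rule. -/
theorem integral_wallCutoff_mul_fderiv_le (hE : IsFinitePerimeterSet E) (n : ℕ) {g : E3 → ℝ}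
    (hg : ContDiff ℝ 1 g) (hc : HasCompactSupport g) {K : ℝ} (hK : ∀ x, |g x| ≤ K) (i : Fin 3) :
    (∫ x in E, wallCutoff n x * fderiv ℝ g x (EuclideanSpace.single i 1)) +
      ∫ x in E, g x * fderiv ℝ (wallCutoff n) x (EuclideanSpace.single i 1) ≤
      K * (perimeter E halfSpace).toReal := by
  have ht := isTestField_wallCutoff_mul n hg hc (EuclideanSpace.single i (1 : ℝ))
  have h := integral_divergence_le_mul_perimeter hE.perimeter_ne_top ht (K := K) fun x => by
    rw [norm_smul, norm_single_one, mul_one, norm_mul, Real.norm_of_nonneg (wallCutoff_nonneg n x)]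
    exact (mul_le_of_le_one_left (norm_nonneg _) (wallCutoff_le_one n x)).trans (hK x)
  refine le_trans (le_of_eq ?_) h
  rw [← integral_add]
  · refine integral_congr_ae (Eventually.of_forall fun x => ?_)
    have d1 := (contDiff_wallCutoff n).differentiable one_ne_zero x
    have d2 := hg.differentiable one_ne_zero x
    simp only
    rw [divergence_smul_const _ _ (d1.fun_mul d2), fderiv_fun_mul d1 d2]
    simp
  · exact integrableOn_of_hasCompactSupport
      ((contDiff_wallCutoff n).continuous.mul (continuous_fderiv_apply hg _))
      (hasCompactSupport_fderiv_apply hc _).mul_left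
  · exact integrableOn_of_hasCompactSupport
      (hg.continuous.mul (continuous_fderiv_apply (contDiff_wallCutoff n) _)) hc.mul_right

/-- The distributional derivatives of `χ_E` on the whole space are bounded functionals with
respect to the supremum norm. -/
theorem IsFinitePerimeterSet.exists_bound (hE : IsFinitePerimeterSet E) :
    ∃ C : ℝ, 0 ≤ C ∧ ∀ (i : Fin 3) (g : E3 → ℝ) (K : ℝ), ContDiff ℝ 1 g → HasCompactSupport g →
      (∀ x, |g x| ≤ K) → |∫ x in E, fderiv ℝ g x (EuclideanSpace.single i 1)| ≤ C * K := by
  obtain ⟨Cu, hCu0, hCu⟩ := exists_cutoff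
  set P := (perimeter E halfSpace).toReal with hP
  have hP0 : 0 ≤ P := ENNReal.toReal_nonneg
  have hup : ∀ (i : Fin 3) (g : E3 → ℝ) (K : ℝ), ContDiff ℝ 1 g → HasCompactSupport g →
      (∀ x, |g x| ≤ K) → ∫ x in E, fderiv ℝ g x (EuclideanSpace.single i 1) ≤
        (2 * P + Cu * volume.real E) * K := by
    intro i g K hg hc hK
    have hK0 : 0 ≤ K := (abs_nonneg _).trans (hK 0)
    have hlim : Tendsto (fun n => ∫ x in E, wallCutoff n x *
        fderiv ℝ g x (EuclideanSpace.single i 1)) atTop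
        (𝓝 (∫ x in E, fderiv ℝ g x (EuclideanSpace.single i 1))) := by
      refine tendsto_integral_of_dominated_convergence
        (fun x => ‖fderiv ℝ g x (EuclideanSpace.single i 1)‖) (fun n => ?_) ?_ (fun n => ?_) ?_
      · exact ((contDiff_wallCutoff n).continuous.mul
          (continuous_fderiv_apply hg _)).aestronglyMeasurable
      · exact (integrableOn_of_hasCompactSupport (continuous_fderiv_apply hg _)
          (hasCompactSupport_fderiv_apply hc _)).norm
      · refine Eventually.of_forall fun x => ?_
        rw [norm_mul, Real.norm_of_nonneg (wallCutoff_nonneg n x)]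
        exact mul_le_of_le_one_left (norm_nonneg _) (wallCutoff_le_one n x)
      · filter_upwards [ae_restrict_mem hE.measurableSet] with x hx
        simpa using (tendsto_wallCutoff (hE.subset hx)).mul_const _
    refine le_of_tendsto' hlim fun n => ?_
    -- The layer term, where the derivative falls on `wallCutoff n`, must be bounded uniformly in
    -- `n`. Testing vertically with a cutoff `u` equal to one on the support of `g` bounds the mass
    -- of the layer by `P + Cu |E|`; the remaining `P` in the constant comes from testing with `g`
    -- itself.
    obtain ⟨u, hu, huc, hu01, hu1, hud⟩ := hCu (tsupport g) hc
    have h1 := integral_wallCutoff_mul_fderiv_le hE n hg hc hK i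
    have h2 := integral_wallCutoff_mul_fderiv_le hE n hu huc (K := 1)
      (fun x => by rw [abs_of_nonneg (hu01 x).1]; exact (hu01 x).2) 2
    have h3 : |∫ x in E, wallCutoff n x * fderiv ℝ u x (EuclideanSpace.single 2 1)| ≤
        Cu * volume.real E := by
      rw [← Real.norm_eq_abs]
      refine norm_setIntegral_le_of_norm_le_const hE.volume_ne_top.lt_top fun x _ => ?_
      rw [norm_mul, Real.norm_of_nonneg (wallCutoff_nonneg n x)]
      refine (mul_le_of_le_one_left (norm_nonneg _) (wallCutoff_le_one n x)).trans ?_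
      refine (ContinuousLinearMap.le_opNorm _ _).trans ?_
      rw [norm_single_one, mul_one]
      exact hud x
    have h4 : |∫ x in E, g x * fderiv ℝ (wallCutoff n) x (EuclideanSpace.single i 1)| ≤
        K * ∫ x in E, u x * fderiv ℝ (wallCutoff n) x (EuclideanSpace.single 2 1) := by
      rw [← Real.norm_eq_abs, ← integral_const_mul]
      refine norm_integral_le_of_norm_le ?_ (Eventually.of_forall fun x => ?_)
      · exact (integrableOn_of_hasCompactSupport
          (hu.continuous.mul (continuous_fderiv_apply (contDiff_wallCutoff n) _))
          huc.mul_right).const_mul K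
      · rw [norm_mul, Real.norm_eq_abs, Real.norm_eq_abs]
        have h5 := abs_fderiv_wallCutoff_le n x i
        have h6 := (abs_nonneg _).trans h5
        by_cases hx : x ∈ tsupport g
        · rw [hu1 x hx, one_mul]
          exact mul_le_mul (hK x) h5 (abs_nonneg _) hK0
        · rw [image_eq_zero_of_notMem_tsupport hx, abs_zero, zero_mul]
          have := (hu01 x).1
          positivity
    have h7 := neg_le_of_abs_le h4
    have h8 := neg_le_of_abs_le h3
    have h9 : ∫ x in E, u x * fderiv ℝ (wallCutoff n) x (EuclideanSpace.single 2 1) ≤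
        P + Cu * volume.real E := by linarith
    have h10 := mul_le_mul_of_nonneg_left h9 hK0
    nlinarith
  refine ⟨2 * P + Cu * volume.real E, by positivity, fun i g K hg hc hK => abs_le.2 ⟨?_, ?_⟩⟩
  · have := hup i (fun x => -g x) K hg.neg
      (by simpa [HasCompactSupport, tsupport, Function.support_fun_neg] using hc)
      (fun x => by simpa using hK x)
    simp only [fderiv_fun_neg, neg_apply, integral_neg] at this
    linarith
  · exact hup i g K hg hc hK

/-- The distributional derivatives of `χ_E` on the whole space are signed measures. -/
theorem IsFinitePerimeterSet.exists_derivative_measures (hE : IsFinitePerimeterSet E) (i : Fin 3) :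
    ∃ μ ν : Measure E3, IsFiniteMeasure μ ∧ IsFiniteMeasure ν ∧
      ∀ g : E3 → ℝ, ContDiff ℝ 1 g → HasCompactSupport g →
        ∫ x in E, fderiv ℝ g x (EuclideanSpace.single i 1) = ∫ x, g x ∂μ - ∫ x, g x ∂ν := by
  obtain ⟨C, hC0, hC⟩ := hE.exists_bound
  have hint : ∀ g : E3 → ℝ, ContDiff ℝ 1 g → HasCompactSupport g →
      IntegrableOn (fun x => fderiv ℝ g x (EuclideanSpace.single i 1)) E := fun g hg hc =>
    integrableOn_of_hasCompactSupport (continuous_fderiv_apply hg _)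
      (hasCompactSupport_fderiv_apply hc _)
  let p : Submodule ℝ (BoundedContinuousFunction E3 ℝ) :=
    { carrier := {f | ContDiff ℝ 1 f ∧ HasCompactSupport f}
      add_mem' := fun ha hb => ⟨ha.1.add hb.1, ha.2.add hb.2⟩
      zero_mem' := ⟨contDiff_const, HasCompactSupport.zero⟩
      smul_mem' := fun c f hf => ⟨hf.1.const_smul c, hf.2.smul_left (f := fun _ => c)⟩ }
  let l : p →ₗ[ℝ] ℝ :=
    { toFun := fun f => ∫ x in E, fderiv ℝ f.1 x (EuclideanSpace.single i 1)
      map_add' := fun f g => by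
        rw [← integral_add (hint _ f.2.1 f.2.2) (hint _ g.2.1 g.2.2)]
        refine integral_congr_ae (Eventually.of_forall fun x => ?_)
        have := fderiv_add (f.2.1.differentiable one_ne_zero x) (g.2.1.differentiable one_ne_zero x)
        simp [this]
      map_smul' := fun c f => by
        rw [RingHom.id_apply, smul_eq_mul, ← integral_const_mul]
        refine integral_congr_ae (Eventually.of_forall fun x => ?_)
        exact congrArg (fun T : E3 →L[ℝ] ℝ => T (EuclideanSpace.single i 1))
          (fderiv_const_smul (f.2.1.differentiable one_ne_zero x) c) }
  let L : StrongDual ℝ p := LinearMap.mkContinuous l C fun f : p =>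
    hC i f.1 ‖f‖ f.2.1 f.2.2 fun x => f.1.norm_coe_le_norm x
  -- Hahn-Banach: any extension will do, since only its values on `C¹` functions with compact
  -- support are used.
  obtain ⟨L', hL', -⟩ := exists_extension_norm_eq p L
  obtain ⟨μ, ν, hμ, hν, h⟩ := exists_signed_representation L'
  refine ⟨μ, ν, hμ, hν, fun g hg hc => ?_⟩
  obtain ⟨B, hB⟩ := hg.continuous.bounded_above_of_compact_support hc
  let f : BoundedContinuousFunction E3 ℝ := BoundedContinuousFunction.ofNormedAddCommGroup g
    hg.continuous B hB
  have e := h f hc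
  rw [show L' f = L ⟨f, hg, hc⟩ from hL' ⟨f, hg, hc⟩] at e
  exact e

/-- Derivative of the translates of a test function integrated over `E`. -/
theorem hasDerivAt_integral_translate (hE : volume E ≠ ⊤) {w : E3 → ℝ} (hw : ContDiff ℝ 1 w)
    (hc : HasCompactSupport w) (v : E3) (s : ℝ) :
    HasDerivAt (fun s : ℝ => ∫ x in E, w (x + s • v))
      (∫ x in E, fderiv ℝ w (x + s • v) v) s := by
  obtain ⟨C, hC⟩ := exists_bound_fderiv hw hc
  obtain ⟨B, hB⟩ := hw.continuous.bounded_above_of_compact_support hc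
  have : IsFiniteMeasure (volume.restrict E) := ⟨by simpa using hE.lt_top⟩
  refine (hasDerivAt_integral_of_dominated_loc_of_deriv_le (F := fun s x => w (x + s • v))
    (F' := fun s x => fderiv ℝ w (x + s • v) v) (bound := fun _ => C * ‖v‖)
    (s := Set.univ) Filter.univ_mem ?_ ?_ ?_ ?_ (integrable_const _) ?_).2
  · refine Eventually.of_forall fun s => Continuous.aestronglyMeasurable ?_
    have := hw.continuous
    fun_prop
  · refine Measure.integrableOn_of_bounded hE (M := B)
      (Continuous.aestronglyMeasurable ?_) (Eventually.of_forall fun x => hB _)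
    have := hw.continuous
    fun_prop
  · have := hw.continuous_fderiv one_ne_zero
    exact Continuous.aestronglyMeasurable (by fun_prop)
  · refine Eventually.of_forall fun x s _ => (ContinuousLinearMap.le_opNorm _ _).trans ?_
    exact mul_le_mul_of_nonneg_right (hC _) (norm_nonneg _)
  · refine Eventually.of_forall fun x s _ => ?_
    have h1 : HasDerivAt (fun s : ℝ => x + s • v) v s := by
      simpa using ((hasDerivAt_id s).smul_const v).const_add x
    exact (hw.differentiable one_ne_zero _).hasFDerivAt.comp_hasDerivAt s h1

end DistributionalDerivative

/-! ### Gauss-Green measures and the reduced boundary. -/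

section GaussGreen

variable {E : Set E3}

/-- De Giorgi's structure theorem: sets of finite perimeter have a Gauss-Green measure. -/
theorem IsFinitePerimeterSet.exists_isGaussGreenPair (hE : IsFinitePerimeterSet E) :
    ∃ (m : Measure E3) (σ : E3 → E3), IsGaussGreenPair E m σ := by
  choose μ ν hμ hν h using hE.exists_derivative_measures
  -- The derivative on the whole space may charge the wall. That part is discarded; fields supported
  -- in `Ω` do not see it.
  let μ' : Fin 3 → Measure E3 := fun i => (μ i).restrict halfSpace
  let ν' : Fin 3 → Measure E3 := fun i => (ν i).restrict halfSpace
  let M : Measure E3 := ∑ i, (μ' i + ν' i)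
  have hM : IsFiniteMeasure M := inferInstance
  have hμf : ∀ i, IsFiniteMeasure (μ' i) := fun i => inferInstance
  have hνf : ∀ i, IsFiniteMeasure (ν' i) := fun i => inferInstance
  have hμd : ∀ i, (μ' i).HaveLebesgueDecomposition M := fun i =>
    Measure.haveLebesgueDecomposition_of_sigmaFinite _ _
  have hνd : ∀ i, (ν' i).HaveLebesgueDecomposition M := fun i =>
    Measure.haveLebesgueDecomposition_of_sigmaFinite _ _
  have hle : ∀ i, μ' i + ν' i ≤ M := fun i =>
    Finset.single_le_sum (f := fun i => μ' i + ν' i) (fun i _ => Measure.zero_le _)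
      (Finset.mem_univ i)
  have hμM : ∀ i, μ' i ≪ M := fun i =>
    Measure.absolutelyContinuous_of_le ((Measure.le_add_right le_rfl).trans (hle i))
  have hνM : ∀ i, ν' i ≪ M := fun i =>
    Measure.absolutelyContinuous_of_le ((Measure.le_add_left le_rfl).trans (hle i))
  let c : Fin 3 → E3 → ℝ := fun i x =>
    ((μ' i).rnDeriv M x).toReal - ((ν' i).rnDeriv M x).toReal
  have hcm : ∀ i, Measurable (c i) := fun i =>
    (Measure.measurable_rnDeriv _ _).ennreal_toReal.sub
      (Measure.measurable_rnDeriv _ _).ennreal_toReal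
  have hci : ∀ i, Integrable (c i) M := fun i =>
    Measure.integrable_toReal_rnDeriv.sub Measure.integrable_toReal_rnDeriv
  -- `s` is the density of the vector measure with respect to the dominating measure `M`. The pair
  -- is its polar decomposition: `m = |s| M` and `σ = s / |s|`.
  let s : E3 → E3 := fun x => ∑ i, c i x • EuclideanSpace.single i (1 : ℝ)
  have hsm : Measurable s := Finset.measurable_sum _ fun i _ => (hcm i).smul_const _
  have hsi : Integrable s M := integrable_finsetSum _ fun i _ => (hci i).smul_const _
  have hinner : ∀ v x, inner ℝ v (s x) = ∑ i, c i x * v i := fun v x => by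
    simp only [s]
    rw [inner_sum]
    refine Finset.sum_congr rfl fun i _ => ?_
    rw [inner_smul_right, EuclideanSpace.inner_single_right]
    simp
  have hMc : M halfSpaceᶜ = 0 := by
    simp only [M, Measure.coe_finsetSum, Finset.sum_apply]
    refine Finset.sum_eq_zero fun i _ => ?_
    rw [Measure.add_apply, Measure.restrict_apply isOpen_halfSpace.measurableSet.compl,
      Measure.restrict_apply isOpen_halfSpace.measurableSet.compl]
    simp
  refine ⟨M.withDensity fun x => ‖s x‖ₑ, fun x => ‖s x‖⁻¹ • s x, ?_, ?_, ?_, ?_, ?_⟩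
  · exact isFiniteMeasure_withDensity hsi.2.ne
  · exact withDensity_absolutelyContinuous _ _ hMc
  · exact hsm.norm.inv.smul hsm
  · rw [ae_withDensity_iff hsm.enorm]
    refine Eventually.of_forall fun x hx => ?_
    have : ‖s x‖ ≠ 0 := by simpa using hx
    rw [norm_smul, norm_inv, norm_norm, inv_mul_cancel₀ this]
  · intro φ hφ
    have hcomp : ∀ i : Fin 3, ContDiff ℝ 1 (fun x => φ x i) ∧ HasCompactSupport fun x => φ x i :=
      fun i => ⟨by have := hφ.1; fun_prop, hφ.2.1.comp_left (g := fun v : E3 => v i) rfl⟩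
    rw [integral_withDensity_eq_integral_toReal_smul hsm.enorm
      (Eventually.of_forall fun x => enorm_lt_top)]
    have e1 : ∫ x in E, divergence φ x =
        ∑ i, ∫ x in E, fderiv ℝ (fun y => φ y i) x (EuclideanSpace.single i 1) := by
      rw [← integral_finsetSum]
      · exact integral_congr_ae (Eventually.of_forall fun x =>
          divergence_eq_sum_fderiv (hφ.1.differentiable one_ne_zero x))
      · exact fun i _ => integrableOn_of_hasCompactSupport
          (continuous_fderiv_apply (hcomp i).1 _) (hasCompactSupport_fderiv_apply (hcomp i).2 _)
    have hz : ∀ (i : Fin 3) (ρ : Measure E3), ∫ x, φ x i ∂ρ = ∫ x in halfSpace, φ x i ∂ρ := by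
      intro i ρ
      refine (setIntegral_eq_integral_of_forall_compl_eq_zero fun x hx => ?_).symm
      rw [image_eq_zero_of_notMem_tsupport fun h' => hx (hφ.2.2 h')]
      rfl
    have hb : ∀ i : Fin 3, ∃ C, ∀ x, ‖φ x i‖ ≤ C := fun i =>
      (hcomp i).1.continuous.bounded_above_of_compact_support (hcomp i).2
    have hii : ∀ i : Fin 3, Integrable (fun x => c i x * φ x i) M := fun i => by
      obtain ⟨C, hC⟩ := hb i
      exact (hci i).mul_bdd (c := C) (hcomp i).1.continuous.aestronglyMeasurable
        (Eventually.of_forall hC)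
    have e2 : ∀ i, ∫ x in E, fderiv ℝ (fun y => φ y i) x (EuclideanSpace.single i 1) =
        ∫ x, c i x * φ x i ∂M := by
      intro i
      obtain ⟨C, hC⟩ := hb i
      rw [h i _ (hcomp i).1 (hcomp i).2, hz i (μ i), hz i (ν i),
        ← integral_rnDeriv_smul (hμM i), ← integral_rnDeriv_smul (hνM i), ← integral_sub]
      · refine integral_congr_ae (Eventually.of_forall fun x => ?_)
        simp only [c, smul_eq_mul]
        ring
      · exact Measure.integrable_toReal_rnDeriv.mul_bdd (c := C)
          (hcomp i).1.continuous.aestronglyMeasurable (Eventually.of_forall hC)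
      · exact Measure.integrable_toReal_rnDeriv.mul_bdd (c := C)
          (hcomp i).1.continuous.aestronglyMeasurable (Eventually.of_forall hC)
    rw [e1, Finset.sum_congr rfl fun i _ => e2 i, ← integral_finsetSum _ fun i _ => hii i]
    refine integral_congr_ae (Eventually.of_forall fun x => ?_)
    simp only [toReal_enorm]
    rw [inner_smul_right, hinner, smul_eq_mul, ← mul_assoc]
    rcases eq_or_ne ‖s x‖ 0 with h0 | h0
    · have h1 : s x = 0 := by simpa using h0
      rw [h0, zero_mul, zero_mul, ← hinner, h1, inner_zero_right]
    · rw [mul_inv_cancel₀ h0, one_mul]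

theorem IsGaussGreenPair.integrable {m : Measure E3} {σ : E3 → E3} (h : IsGaussGreenPair E m σ) :
    Integrable σ m := by
  have := h.finite
  exact Integrable.of_bound h.measurable.aestronglyMeasurable 1
    (h.norm_eq_one.mono fun x hx => hx.le)

/-- The Gauss-Green measure vanishes where `E` has no distributional derivative. -/
theorem IsGaussGreenPair.measure_eq_zero {m : Measure E3} {σ : E3 → E3}
    (h : IsGaussGreenPair E m σ) {U : Set E3} (hU : IsOpen U) (hUΩ : U ⊆ halfSpace)
    (h0 : ∀ φ, IsTestField U φ → ∫ x in E, divergence φ x = 0) : m U = 0 := by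
  have := h.finite
  have hz : ∀ i : Fin 3, ∀ᵐ x ∂m, x ∈ U → σ x i = 0 := by
    intro i
    refine hU.ae_eq_zero_of_integral_contDiff_smul_eq_zero (f := fun x => σ x i)
      ((Integrable.locallyIntegrable ?_).locallyIntegrableOn _) fun g hg hc hgU => ?_
    · exact (EuclideanSpace.proj i : E3 →L[ℝ] ℝ).integrable_comp h.integrable
    · have ht : IsTestField U fun x => g x • EuclideanSpace.single i (1 : ℝ) :=
        ⟨(hg.of_le (by exact_mod_cast le_top)).smul contDiff_const, hc.smul_right,
          (tsupport_smul_subset_left g _).trans hgU⟩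
      have e := h.integral_eq _ ⟨ht.1, ht.2.1, ht.2.2.trans hUΩ⟩
      rw [h0 _ ht] at e
      rw [e]
      refine integral_congr_ae (Eventually.of_forall fun x => ?_)
      simp only
      rw [inner_smul_left, EuclideanSpace.inner_single_left]
      simp
  have hall : ∀ᵐ x ∂m, x ∉ U := by
    filter_upwards [ae_all_iff.2 hz, h.norm_eq_one] with x hx h1 hxU
    have : σ x = 0 := by
      ext i
      simpa using hx i hxU
    rw [this, norm_zero] at h1
    exact zero_ne_one h1
  simpa [ae_iff] using hall

/-- An open ball is exhausted by concentric closed balls. -/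
theorem exists_seq_iUnion_closedBall (x : E3) {r : ℝ} (hr : 0 < r) :
    ∃ t : ℕ → ℝ, StrictMono t ∧ (∀ n, t n ∈ Set.Ioo 0 r) ∧ Tendsto t atTop (𝓝 r) ∧
      ⋃ n, Metric.closedBall x (t n) = Metric.ball x r := by
  obtain ⟨t, htm, ht, htl⟩ := exists_seq_strictMono_tendsto' hr
  refine ⟨t, htm, ht, htl, ?_⟩
  ext y
  simp only [Set.mem_iUnion, Metric.mem_closedBall, Metric.mem_ball]
  constructor
  · rintro ⟨n, hn⟩
    exact hn.trans_lt (ht n).2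
  · intro hy
    obtain ⟨n, hn⟩ := (htl.eventually (lt_mem_nhds hy)).exists
    exact ⟨n, hn.le⟩

/-- The differentiation theorem speaks of closed balls and `reducedBoundary` of open ones; an open
ball is the increasing union of closed balls, so its average is a limit of theirs. -/
theorem tendsto_average_ball {m : Measure E3} [IsFiniteMeasure m] {σ : E3 → E3}
    (hσ : Integrable σ m) {x ν : E3} (hpos : ∀ r : ℝ, 0 < r → 0 < m (Metric.ball x r))
    (h : Tendsto (fun r : ℝ => ⨍ y in Metric.closedBall x r, σ y ∂m) (𝓝[>] 0) (𝓝 ν)) :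
    Tendsto (fun r : ℝ => ⨍ y in Metric.ball x r, σ y ∂m) (𝓝[>] 0) (𝓝 ν) := by
  rw [Metric.nhds_basis_closedBall.tendsto_right_iff] at h ⊢
  intro ε hε
  have := h ε hε
  rw [eventually_nhdsWithin_iff, Metric.eventually_nhds_iff] at this ⊢
  obtain ⟨δ, hδ, H⟩ := this
  refine ⟨δ, hδ, fun r hrδ hr => ?_⟩
  have hr0 : 0 < r := hr
  obtain ⟨t, htm, ht, htl, hU⟩ := exists_seq_iUnion_closedBall x hr0
  have hmono : Monotone fun n => Metric.closedBall x (t n) := fun a b hab =>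
    Metric.closedBall_subset_closedBall (htm.monotone hab)
  have l1 : Tendsto (fun n => m.real (Metric.closedBall x (t n))) atTop
      (𝓝 (m.real (Metric.ball x r))) := by
    rw [← hU]
    exact (ENNReal.tendsto_toReal (measure_ne_top _ _)).comp (tendsto_measure_iUnion_atTop hmono)
  have l2 : Tendsto (fun n => ∫ y in Metric.closedBall x (t n), σ y ∂m) atTop
      (𝓝 (∫ y in Metric.ball x r, σ y ∂m)) := by
    rw [← hU]
    exact tendsto_setIntegral_of_monotone (fun n => Metric.isClosed_closedBall.measurableSet) hmono
      hσ.integrableOn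
  have hne : m.real (Metric.ball x r) ≠ 0 :=
    (ENNReal.toReal_pos (hpos r hr0).ne' (measure_ne_top _ _)).ne'
  have l3 : Tendsto (fun n => ⨍ y in Metric.closedBall x (t n), σ y ∂m) atTop
      (𝓝 (⨍ y in Metric.ball x r, σ y ∂m)) := by
    simp_rw [setAverage_eq]
    exact (l1.inv₀ hne).smul l2
  refine Metric.isClosed_closedBall.mem_of_tendsto l3 (Eventually.of_forall fun n => ?_)
  refine H ?_ (ht n).1
  rw [dist_zero_right, Real.norm_of_nonneg (ht n).1.le]
  rw [dist_zero_right, Real.norm_of_nonneg hr0.le] at hrδ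
  exact (ht n).2.trans hrδ

/-- The reduced boundary meets every set charged by the Gauss-Green measure. -/
theorem IsGaussGreenPair.exists_mem_reducedBoundary {m : Measure E3} {σ : E3 → E3}
    (h : IsGaussGreenPair E m σ) {U : Set E3} (hm : m U ≠ 0) :
    ∃ x ∈ U, x ∈ reducedBoundary E := by
  have := h.finite
  have hav := (Besicovitch.vitaliFamily m).ae_tendsto_average (f := σ)
    h.integrable.locallyIntegrable
  have hΩ : ∀ᵐ x ∂m, x ∈ halfSpace := by
    rw [ae_iff]
    exact h.compl_null
  -- By Lebesgue differentiation `G` has full `m`-measure, so `U ∩ G` is charged. It then contains a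
  -- point all of whose neighbourhoods are charged, and such a point lies in the reduced boundary.
  let G : Set E3 := {x | x ∈ halfSpace ∧ ‖σ x‖ = 1 ∧
    Tendsto (fun a => ⨍ y in a, σ y ∂m) ((Besicovitch.vitaliFamily m).filterAt x) (𝓝 (σ x))}
  have hG : ∀ᵐ x ∂m, x ∈ G := by
    filter_upwards [hav, hΩ, h.norm_eq_one] with x h1 h2 h3 using ⟨h2, h3, h1⟩
  have hUG : m (U ∩ G) ≠ 0 := by
    rwa [measure_inter_conull (s := U) (t := G) (mem_ae_iff.1 hG)]
  obtain ⟨x, ⟨hxU, hxΩ, hx1, hxt⟩, hx⟩ := exists_mem_forall_mem_nhdsWithin_pos_measure hUG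
  have hpos : ∀ r : ℝ, 0 < r → 0 < m (Metric.ball x r) := fun r hr =>
    hx _ (mem_nhdsWithin_of_mem_nhds (Metric.ball_mem_nhds x hr))
  exact ⟨x, hxU, hxΩ, m, σ, h, hpos, σ x, hx1,
    tendsto_average_ball h.integrable hpos (hxt.comp (Besicovitch.tendsto_filterAt m x))⟩

end GaussGreen

/-! ### Comparison of the distances to reduced boundaries. -/

section BoundaryDistance

variable {E : Set E3}

/-- Smooth functions with support in a ball increase to its characteristic function. -/
theorem exists_smooth_approximation_ball (c : E3) {r : ℝ} (hr : 0 < r) :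
    ∃ w : ℕ → E3 → ℝ, (∀ n, ContDiff ℝ 1 (w n)) ∧ (∀ n, HasCompactSupport (w n)) ∧
      (∀ n, tsupport (w n) ⊆ Metric.ball c r) ∧ (∀ n x, |w n x| ≤ 1) ∧
      ∀ x, Tendsto (fun n => w n x) atTop (𝓝 ((Metric.ball c r).indicator 1 x)) := by
  let b : ℕ → ContDiffBump c := fun n =>
    ⟨r * (1 - 1 / ((n : ℝ) + 2)), r * (1 - 1 / ((n : ℝ) + 3)), by
      have : 1 / ((n : ℝ) + 2) < 1 := by
        rw [div_lt_one (by positivity)]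
        linarith [(Nat.cast_nonneg n : (0 : ℝ) ≤ n)]
      exact mul_pos hr (by linarith), by
      have : 1 / ((n : ℝ) + 3) < 1 / ((n : ℝ) + 2) :=
        one_div_lt_one_div_of_lt (by positivity) (by linarith)
      exact mul_lt_mul_of_pos_left (by linarith) hr⟩
  have hout : ∀ n, (b n).rOut < r := fun n => by
    have : 0 < 1 / ((n : ℝ) + 3) := by positivity
    have : r * (1 - 1 / ((n : ℝ) + 3)) < r * 1 := mul_lt_mul_of_pos_left (by linarith) hr
    simpa [b] using this
  have hts : ∀ n, tsupport (b n) ⊆ Metric.ball c r := fun n => by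
    rw [(b n).tsupport_eq]
    exact Metric.closedBall_subset_ball (hout n)
  refine ⟨fun n => b n, fun n => (b n).contDiff, fun n => (b n).hasCompactSupport, hts,
    fun n x => by rw [abs_of_nonneg (b n).nonneg]; exact (b n).le_one, fun x => ?_⟩
  by_cases hx : x ∈ Metric.ball c r
  · have hlim : Tendsto (fun n : ℕ => r * (1 - 1 / ((n : ℝ) + 2))) atTop (𝓝 r) := by
      have h1 : Tendsto (fun n : ℕ => 1 / ((n : ℝ) + 2)) atTop (𝓝 0) := by
        have := (tendsto_const_nhds (x := (1 : ℝ))).div_atTop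
          (tendsto_atTop_add_const_right atTop (2 : ℝ) tendsto_natCast_atTop_atTop)
        simpa using this
      have := ((tendsto_const_nhds (x := (1 : ℝ))).sub h1).const_mul r
      simpa using this
    refine tendsto_const_nhds.congr' ?_
    filter_upwards [hlim.eventually (lt_mem_nhds (Metric.mem_ball.1 hx))] with n hn
    rw [Set.indicator_of_mem hx, (b n).one_of_mem_closedBall (Metric.mem_closedBall.2 hn.le)]
    rfl
  · rw [Set.indicator_of_notMem hx]
    refine tendsto_const_nhds.congr fun n => ?_
    exact (image_eq_zero_of_notMem_tsupport fun h => hx (hts n h)).symm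

theorem setIntegral_indicator_ball (c : E3) (r : ℝ) :
    ∫ x in E, (Metric.ball c r).indicator (1 : E3 → ℝ) x = volume.real (E ∩ Metric.ball c r) := by
  rw [integral_indicator_one Metric.isOpen_ball.measurableSet,
    measureReal_restrict_apply Metric.isOpen_ball.measurableSet, Set.inter_comm]

/-- The volume of `E` in small balls is locally constant where `E` has no distributional
derivative. -/
theorem volume_inter_ball_eq_of_divergence_free (hE : volume E ≠ ⊤) {U : Set E3} (hU : Convex ℝ U)
    (h0 : ∀ φ, IsTestField U φ → ∫ x in E, divergence φ x = 0) {x z : E3} {r : ℝ} (hr : 0 < r)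
    (hx : Metric.ball x r ⊆ U) (hz : Metric.ball z r ⊆ U) :
    volume (E ∩ Metric.ball x r) = volume (E ∩ Metric.ball z r) := by
  set v := z - x with hv
  -- Slide `w` from the ball at `z` to the ball at `x`. By convexity the support stays in `U`, and
  -- the derivative of the integral is that of the divergence of a translate of `w • v`, hence zero.
  have key : ∀ w : E3 → ℝ, ContDiff ℝ 1 w → HasCompactSupport w → tsupport w ⊆ Metric.ball z r →
      ∫ y in E, w y = ∫ y in E, w (y + v) := by
    intro w hw hc hs
    have hderiv : ∀ s ∈ Set.Icc (0 : ℝ) 1,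
        HasDerivAt (fun s : ℝ => ∫ y in E, w (y + s • v)) 0 s := by
      intro s hs1
      have h1 := hasDerivAt_integral_translate hE hw hc v s
      have hf : IsTestField (Metric.ball z r) fun y => w y • v :=
        ⟨hw.smul contDiff_const, hc.smul_right, (tsupport_smul_subset_left w _).trans hs⟩
      have hf' := hf.comp_add_right (y := s • v) (U := U) fun y hy => by
        have hy1 : y - v ∈ Metric.ball x r := by
          rw [Metric.mem_ball, dist_eq_norm] at hy ⊢
          rwa [hv, show y - (z - x) - x = y - z by abel]
        have := hU.add_smul_sub_mem (hz hy) (hx hy1) hs1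
        rwa [sub_sub_cancel_left, smul_neg, ← sub_eq_add_neg] at this
      have h2 := h0 _ hf'
      simp_rw [divergence_comp_add_right (fun y => w y • v),
        fun y => divergence_smul_const v y (hw.differentiable one_ne_zero y)] at h2
      rwa [h2] at h1
    have := constant_of_has_deriv_right_zero (a := (0 : ℝ)) (b := 1)
      (f := fun s : ℝ => ∫ y in E, w (y + s • v))
      (fun s hs => (hderiv s hs).continuousAt.continuousWithinAt)
      (fun s hs => (hderiv s ⟨hs.1, hs.2.le⟩).hasDerivWithinAt) 1 (by simp)
    simpa using this.symm
  obtain ⟨w, hw, hc, hs, h1, hl⟩ := exists_smooth_approximation_ball z hr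
  have hfin : IsFiniteMeasure (volume.restrict E) := ⟨by simpa using hE.lt_top⟩
  have l1 : Tendsto (fun n => ∫ y in E, w n y) atTop
      (𝓝 (∫ y in E, (Metric.ball z r).indicator (1 : E3 → ℝ) y)) :=
    tendsto_integral_of_dominated_convergence (fun _ => 1)
      (fun n => (hw n).continuous.aestronglyMeasurable) (integrable_const _)
      (fun n => Eventually.of_forall (h1 n)) (Eventually.of_forall hl)
  have l2 : Tendsto (fun n => ∫ y in E, w n (y + v)) atTop
      (𝓝 (∫ y in E, (Metric.ball z r).indicator (1 : E3 → ℝ) (y + v))) :=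
    tendsto_integral_of_dominated_convergence (fun _ => 1)
      (fun n => ((hw n).continuous.comp (continuous_add_const v)).aestronglyMeasurable)
      (integrable_const _)
      (fun n => Eventually.of_forall fun y => h1 n _) (Eventually.of_forall fun y => hl _)
  have e := tendsto_nhds_unique l1 (l2.congr fun n => (key _ (hw n) (hc n) (hs n)).symm)
  have e2 : (fun y => (Metric.ball z r).indicator (1 : E3 → ℝ) (y + v)) =
      (Metric.ball x r).indicator (1 : E3 → ℝ) := by
    ext y
    have : y + v ∈ Metric.ball z r ↔ y ∈ Metric.ball x r := by
      rw [Metric.mem_ball, Metric.mem_ball, dist_eq_norm, dist_eq_norm, hv,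
        show y + (z - x) - z = y - x by abel]
    by_cases hy : y ∈ Metric.ball x r
    · rw [Set.indicator_of_mem hy, Set.indicator_of_mem (this.2 hy)]; rfl
    · rw [Set.indicator_of_notMem hy, Set.indicator_of_notMem fun h => hy (this.1 h)]
  rw [e2, setIntegral_indicator_ball, setIntegral_indicator_ball] at e
  have hft : ∀ c, volume (E ∩ Metric.ball c r) ≠ ⊤ := fun c =>
    ne_top_of_le_ne_top hE (measure_mono Set.inter_subset_left)
  exact ((ENNReal.toReal_eq_toReal_iff' (hft _) (hft _)).1 e).symm

/-- A convex open set in the half-space containing a point of density one and a point which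
is not of density one meets the reduced boundary. -/
theorem IsBVSet.exists_mem_reducedBoundary (hE : IsBVSet E) {U : Set E3} (hU : IsOpen U)
    (hUc : Convex ℝ U) (hUΩ : U ⊆ halfSpace) {x z : E3} (hx : x ∈ U) (hz : z ∈ U) (hxE : x ∉ E)
    (hzE : z ∈ E) : ∃ y ∈ U, y ∈ reducedBoundary E := by
  obtain ⟨m, σ, h⟩ := hE.isFinitePerimeterSet.exists_isGaussGreenPair
  -- If `m U = 0`, then `E` fills equal volumes of equal small balls about `x` and `z`, so density
  -- one at `z` passes to `x`.
  refine h.exists_mem_reducedBoundary fun hm => hxE ?_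
  have hfree : ∀ φ, IsTestField U φ → ∫ y in E, divergence φ y = 0 := by
    intro φ hφ
    rw [h.integral_eq φ ⟨hφ.1, hφ.2.1, hφ.2.2.trans hUΩ⟩]
    refine integral_eq_zero_of_ae ?_
    have : ∀ᵐ y ∂m, y ∉ U := by simpa [ae_iff] using hm
    filter_upwards [this] with y hy
    rw [image_eq_zero_of_notMem_tsupport fun h' => hy (hφ.2.2 h')]
    simp
  obtain ⟨r₁, hr₁, h₁⟩ := Metric.isOpen_iff.1 hU x hx
  obtain ⟨r₂, hr₂, h₂⟩ := Metric.isOpen_iff.1 hU z hz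
  rw [← hE.densityOne_eq] at hzE ⊢
  have hzE' : Tendsto _ _ _ := hzE
  refine Tendsto.congr' (f₁ := _) ?_ hzE'
  filter_upwards [Ioo_mem_nhdsGT (lt_min hr₁ hr₂)] with r hr
  rw [volume_inter_ball_eq_of_divergence_free hE.volume_lt_top.ne hUc hfree hr.1
    ((Metric.ball_subset_ball (hr.2.le.trans (min_le_right _ _))).trans h₂)
    ((Metric.ball_subset_ball (hr.2.le.trans (min_le_left _ _))).trans h₁),
    Measure.addHaar_ball_center volume z, Measure.addHaar_ball_center volume x]

theorem convex_halfSpace : Convex ℝ halfSpace := by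
  intro x hx y hy a b ha hb hab
  have hx' : 0 < x 2 := hx
  have hy' : 0 < y 2 := hy
  change 0 < (a • x + b • y) 2
  simp only [PiLp.add_apply, PiLp.smul_apply, smul_eq_mul]
  rcases ha.eq_or_lt with rfl | ha
  · have : b = 1 := by linarith
    subst this
    simpa using hy'
  · have h1 := mul_pos ha hx'
    have h2 := mul_nonneg hb hy'.le
    linarith

/-- A ball about either point with radius slightly larger than their distance, cut with the
half-space, is convex and contains both points; hence it meets the reduced boundary. -/
theorem IsBVSet.bdryDist_le_edist (hE : IsBVSet E) {x z : E3} (hx : x ∈ halfSpace)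
    (hxE : x ∉ E) (hzE : z ∈ E) :
    bdryDist E x ≤ edist x z ∧ bdryDist E z ≤ edist x z := by
  have key : ∀ c, c ∈ ({x, z} : Set E3) → bdryDist E c ≤ edist x z := by
    intro c hc
    refine ENNReal.le_of_forall_pos_le_add fun ε hε _ => ?_
    have hd : ∀ y ∈ ({x, z} : Set E3), y ∈ Metric.ball c (dist x z + ε) := by
      intro y hy
      rw [Metric.mem_ball]
      have : (0 : ℝ) < ε := hε
      rcases hc with rfl | rfl <;> rcases hy with rfl | rfl <;>
        simp only [dist_self, dist_comm] <;>
        first | positivity | (rw [dist_comm]; linarith)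
    obtain ⟨y, hyU, hy⟩ := hE.exists_mem_reducedBoundary
      (Metric.isOpen_ball.inter isOpen_halfSpace) ((convex_ball c (dist x z + ε)).inter
        convex_halfSpace) Set.inter_subset_right ⟨hd x (by simp), hx⟩
      ⟨hd z (by simp), hE.subset hzE⟩ hxE hzE
    refine (Metric.infEDist_le_edist_of_mem hy).trans ?_
    have h1 : dist c y ≤ dist x z + ε := by
      rw [dist_comm]
      exact (Metric.mem_ball.1 hyU.1).le
    rw [edist_dist, edist_dist, ← ENNReal.ofReal_coe_nnreal,
      ← ENNReal.ofReal_add dist_nonneg ε.coe_nonneg]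
    exact ENNReal.ofReal_le_ofReal h1
  exact ⟨key x (by simp), key z (by simp)⟩

/-- Points of the reduced boundary are limits of points of `E` and of its complement. -/
theorem exists_near_of_mem_reducedBoundary {y : E3}
    (hy : y ∈ reducedBoundary E) {ε : ℝ} (hε : 0 < ε) :
    (∃ z ∈ E, dist y z < ε) ∧ ∃ z ∈ halfSpace, z ∉ E ∧ dist y z < ε := by
  obtain ⟨hyΩ, m, σ, h, hpos, -⟩ := hy
  obtain ⟨r, hr, hrΩ⟩ := Metric.isOpen_iff.1 isOpen_halfSpace y hyΩ
  have hmin : 0 < min r ε := lt_min hr hε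
  have hB : Metric.ball y (min r ε) ⊆ halfSpace :=
    (Metric.ball_subset_ball (min_le_left _ _)).trans hrΩ
  have hlt : ∀ z ∈ Metric.ball y (min r ε), dist y z < ε := fun z hz => by
    rw [dist_comm]
    exact (Metric.mem_ball.1 hz).trans_le (min_le_right _ _)
  -- If the ball misses `E`, or lies in `E`, every field supported in it has zero divergence
  -- integral over `E`, so `m` vanishes on the ball. This contradicts `hpos`.
  have hdiv : ∀ φ, IsTestField (Metric.ball y (min r ε)) φ →
      ∀ z, z ∉ Metric.ball y (min r ε) → divergence φ z = 0 := by
    intro φ hφ z hz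
    have : fderiv ℝ φ z = 0 := by
      by_contra h'
      exact hz (hφ.2.2 (support_fderiv_subset ℝ h'))
    simp [divergence, this]
  constructor
  · by_contra hcon
    push Not at hcon
    refine (hpos _ hmin).ne' (h.measure_eq_zero Metric.isOpen_ball hB fun φ hφ => ?_)
    refine setIntegral_eq_zero_of_forall_eq_zero fun z hz => hdiv φ hφ z fun hzB => ?_
    exact absurd (hlt z hzB) (not_lt.2 (hcon z hz))
  · by_contra hcon
    push Not at hcon
    refine (hpos _ hmin).ne' (h.measure_eq_zero Metric.isOpen_ball hB fun φ hφ => ?_)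
    rw [setIntegral_eq_integral_of_forall_compl_eq_zero fun z hz => hdiv φ hφ z fun hzB => ?_,
      hφ.integral_divergence]
    exact absurd (hlt z hzB) (not_lt.2 (hcon z (hB hzB) hz))

/-- Points of the reduced boundary need not belong to any of the sets compared; this replaces them
by nearby points of `S`, taken to be the inner set or the complement of the outer one. -/
theorem le_bdryDist_of_forall {F : Set E3} {a : ENNReal} {x : E3} {S : Set E3}
    (hS : ∀ y ∈ reducedBoundary F, ∀ ε : ℝ, 0 < ε → ∃ z ∈ S, dist y z < ε)
    (h : ∀ z ∈ S, a ≤ edist x z) : a ≤ bdryDist F x := by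
  refine Metric.le_infEDist.2 fun y hy => ENNReal.le_of_forall_pos_le_add fun ε hε _ => ?_
  obtain ⟨z, hz, hd⟩ := hS y hy ε hε
  refine (h z hz).trans ((edist_triangle x y z).trans ?_)
  gcongr
  rw [edist_dist, ← ENNReal.ofReal_coe_nnreal]
  exact ENNReal.ofReal_le_ofReal hd.le

variable {F : Set E3}

/-- The distance functions of nested sets are ordered outside the larger set. -/
theorem IsBVSet.bdryDist_le_of_subset (hE : IsBVSet E) (h : F ⊆ E)
    {x : E3} (hx : x ∈ halfSpace) (hxE : x ∉ E) : bdryDist E x ≤ bdryDist F x :=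
  le_bdryDist_of_forall (S := F) (fun _ hy _ hε => (exists_near_of_mem_reducedBoundary hy hε).1)
    fun _ hz => (hE.bdryDist_le_edist hx hxE (h hz)).1

/-- The distance functions of nested sets are ordered inside the smaller set. -/
theorem IsBVSet.bdryDist_le_of_subset_of_mem (hF : IsBVSet F) (h : F ⊆ E)
    {x : E3} (hx : x ∈ F) : bdryDist F x ≤ bdryDist E x :=
  le_bdryDist_of_forall (S := halfSpace \ E)
    (fun _ hy _ hε => by
      obtain ⟨z, h1, h2, h3⟩ := (exists_near_of_mem_reducedBoundary hy hε).2
      exact ⟨z, ⟨h1, h2⟩, h3⟩)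
    fun z hz => by
      rw [edist_comm]
      exact (hF.bdryDist_le_edist hz.1 (fun h' => hz.2 (h h')) hx).2

/-- The distance functions of disjoint sets are ordered inside each of the sets. -/
theorem IsBVSet.bdryDist_le_of_disjoint (hE : IsBVSet E) (h : E ∩ F = ∅)
    {x : E3} (hx : x ∈ E) (hFΩ : F ⊆ halfSpace) : bdryDist E x ≤ bdryDist F x :=
  le_bdryDist_of_forall (S := F) (fun _ hy _ hε => (exists_near_of_mem_reducedBoundary hy hε).1)
    fun z hz => by
      rw [edist_comm]
      exact (hE.bdryDist_le_edist (hFΩ hz)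
        (fun h' => (Set.eq_empty_iff_forall_notMem.1 h z) ⟨h', hz⟩) hx).2

end BoundaryDistance

/-! ### Area on the wall and densities of measures swept by half-balls. -/

section Wall

open scoped Pointwise

/-- The isometric parametrization of the wall. -/
def wallEmbedding (y : EuclideanSpace ℝ (Fin 2)) : E3 := !₂[y 0, y 1, 0]

theorem isometry_wallEmbedding : Isometry wallEmbedding := by
  refine Isometry.of_dist_eq fun x y => ?_
  simp [EuclideanSpace.dist_eq, wallEmbedding, Fin.sum_univ_three]

theorem range_wallEmbedding : Set.range wallEmbedding = wall := by
  ext x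
  constructor
  · rintro ⟨y, rfl⟩
    simp [wall, wallEmbedding]
  · intro hx
    have hx' : x 2 = 0 := hx
    refine ⟨!₂[x 0, x 1], ?_⟩
    ext i
    fin_cases i <;> simp [wallEmbedding, hx']

theorem isClosed_wall : IsClosed wall :=
  isClosed_eq (by fun_prop) continuous_const

theorem wallMeasure_eq_map : wallMeasure = volume.map wallEmbedding := by
  rw [wallMeasure, ← EuclideanSpace.euclideanHausdorffMeasure_eq_volume 2,
    isometry_wallEmbedding.map_euclideanHausdorffMeasure, range_wallEmbedding]

theorem ae_mem_wall : ∀ᵐ x ∂wallMeasure, x ∈ wall :=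
  ae_restrict_mem isClosed_wall.measurableSet

/-- The area of the unit disc. -/
def discArea : ℝ := volume.real (Metric.ball (0 : EuclideanSpace ℝ (Fin 2)) 1)

theorem discArea_pos : 0 < discArea :=
  ENNReal.toReal_pos (Metric.measure_ball_pos _ _ one_pos).ne' Metric.isBounded_ball.measure_lt_top.ne

theorem wallMeasure_closedBall {x : E3} (hx : x ∈ wall) {r : ℝ} (hr : 0 ≤ r) :
    wallMeasure (Metric.closedBall x r) = ENNReal.ofReal (r ^ 2 * discArea) := by
  rw [← range_wallEmbedding] at hx
  obtain ⟨y, rfl⟩ := hx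
  rw [wallMeasure_eq_map, Measure.map_apply isometry_wallEmbedding.continuous.measurable
    Metric.isClosed_closedBall.measurableSet, isometry_wallEmbedding.preimage_closedBall,
    Measure.addHaar_closedBall _ _ hr, ENNReal.ofReal_mul (by positivity), discArea,
    Measure.real, ENNReal.ofReal_toReal Metric.isBounded_ball.measure_lt_top.ne]
  simp

instance : IsLocallyFiniteMeasure wallMeasure := by
  refine ⟨fun x => ⟨Metric.closedBall 0 (‖x‖ + 1), ?_, ?_⟩⟩
  · refine Filter.mem_of_superset (Metric.ball_mem_nhds x one_pos) fun y hy => ?_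
    rw [mem_closedBall_zero_iff]
    have := norm_le_norm_add_norm_sub' y x
    rw [Metric.mem_ball, dist_eq_norm] at hy
    linarith
  · rw [wallMeasure_closedBall (by simp [wall]) (by positivity)]
    exact ENNReal.ofReal_lt_top

theorem volume_halfSpace_inter_ball {x : E3} (hx : x ∈ wall) {r : ℝ} (hr : 0 < r) :
    volume.real (halfSpace ∩ Metric.ball x r) =
      r ^ 3 * volume.real (halfSpace ∩ Metric.ball (0 : E3) 1) := by
  have hx' : x 2 = 0 := hx
  have e : halfSpace ∩ Metric.ball x r =
      (fun y => y + -x) ⁻¹' (r • (halfSpace ∩ Metric.ball (0 : E3) 1)) := by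
    ext y
    rw [Set.mem_preimage, Set.mem_smul_set_iff_inv_smul_mem₀ hr.ne']
    have h1 : y ∈ halfSpace ↔ r⁻¹ • (y + -x) ∈ halfSpace := by
      change 0 < y 2 ↔ 0 < (r⁻¹ • (y + -x)) 2
      simp [hx', hr]
    have h2 : y ∈ Metric.ball x r ↔ r⁻¹ • (y + -x) ∈ Metric.ball (0 : E3) 1 := by
      rw [mem_ball_zero_iff, norm_smul, norm_inv, Real.norm_of_nonneg hr.le,
        inv_mul_lt_iff₀ hr, mul_one, Metric.mem_ball, dist_eq_norm, sub_eq_add_neg]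
    rw [Set.mem_inter_iff, Set.mem_inter_iff, h1, h2]
  rw [e, Measure.real, measure_preimage_add_right, Measure.addHaar_smul]
  simp only [finrank_euclideanSpace, Fintype.card_fin, abs_pow, abs_of_pos hr, ENNReal.toReal_mul,
    Measure.real]
  rw [ENNReal.toReal_ofReal (by positivity)]

theorem volume_halfBall_pos : 0 < volume.real (halfSpace ∩ Metric.ball (0 : E3) 1) := by
  refine ENNReal.toReal_pos ?_ ?_
  · refine ((isOpen_halfSpace.inter Metric.isOpen_ball).measure_pos volume
      ⟨EuclideanSpace.single 2 (1 / 2), ?_, ?_⟩).ne'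
    · simp [halfSpace]
    · rw [mem_ball_zero_iff]
      simp
      norm_num
  · exact ne_top_of_le_ne_top Metric.isBounded_ball.measure_lt_top.ne
      (measure_mono Set.inter_subset_right)

/-- The densities of a finite measure with respect to the area of the wall. -/
theorem ae_tendsto_closedBall_div (ρ : Measure E3) [IsFiniteMeasure ρ] :
    ∀ᵐ x ∂wallMeasure, Tendsto (fun r => ρ.real (Metric.closedBall x r) / r ^ 2) (𝓝[>] 0)
      (𝓝 (discArea * (ρ.rnDeriv wallMeasure x).toReal)) := by
  filter_upwards [Besicovitch.ae_tendsto_rnDeriv ρ wallMeasure, ae_mem_wall,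
    ρ.rnDeriv_lt_top wallMeasure] with x h hx hlt
  have h1 := ((ENNReal.tendsto_toReal hlt.ne).comp h).const_mul discArea
  refine h1.congr' ?_
  filter_upwards [self_mem_nhdsWithin] with r hr
  have hr : 0 < r := hr
  have hd := discArea_pos
  rw [Function.comp_apply, wallMeasure_closedBall hx hr.le, ENNReal.toReal_div,
    ENNReal.toReal_ofReal (by positivity), Measure.real]
  field_simp

theorem ball_estimate_of_closedBall {ρ : Measure E3} [IsFiniteMeasure ρ] {x : E3} {a ε δ : ℝ}
    (h : ∀ r, 0 < r → r < δ → |ρ.real (Metric.closedBall x r) - a * r ^ 2| ≤ ε * r ^ 2) {r : ℝ}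
    (hr : 0 < r) (hrδ : r < δ) : |ρ.real (Metric.ball x r) - a * r ^ 2| ≤ ε * r ^ 2 := by
  obtain ⟨t, htm, ht, htl, hU⟩ := exists_seq_iUnion_closedBall x hr
  have l1 : Tendsto (fun n => ρ.real (Metric.closedBall x (t n))) atTop
      (𝓝 (ρ.real (Metric.ball x r))) := by
    rw [← hU]
    exact (ENNReal.tendsto_toReal (measure_ne_top _ _)).comp (tendsto_measure_iUnion_atTop
      fun a b hab => Metric.closedBall_subset_closedBall (htm.monotone hab))
  exact le_of_tendsto_of_tendsto' (l1.sub ((htl.pow 2).const_mul a)).abs ((htl.pow 2).const_mul ε)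
    fun n => h _ (ht n).1 ((ht n).2.trans hrδ)

/-- The upward unit vector. -/
def vertical : E3 := EuclideanSpace.single 2 1

/-- Pythagoras: a ball lowered by `s` cuts the wall in a disc of squared radius `r² - s²`. -/
theorem inter_wall_ball_sub {x : E3} (hx : x ∈ wall) {r s : ℝ} (hs : s ∈ Set.Icc 0 r) :
    Metric.ball (x - s • vertical) r ∩ wall = Metric.ball x (√(r ^ 2 - s ^ 2)) ∩ wall := by
  have hx' : x 2 = 0 := hx
  ext y
  simp only [Set.mem_inter_iff, and_congr_left_iff]
  intro hy
  have hy' : y 2 = 0 := hy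
  have e : ‖y - (x - s • vertical)‖ ^ 2 = ‖y - x‖ ^ 2 + s ^ 2 := by
    simp [EuclideanSpace.norm_sq_eq, Fin.sum_univ_three, vertical, hx', hy']
  rw [Metric.mem_ball, Metric.mem_ball, dist_eq_norm, dist_eq_norm,
    Real.lt_sqrt (norm_nonneg _), lt_sub_iff_add_lt, ← e,
    sq_lt_sq₀ (norm_nonneg _) (hs.1.trans hs.2)]

theorem norm_vertical : ‖vertical‖ = 1 := by simp [vertical]

theorem intervalIntegrable_measure_ball (ρ : Measure E3) [IsFiniteMeasure ρ] (x : E3) (r a b : ℝ) :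
    IntervalIntegrable (fun s : ℝ => ρ.real (Metric.ball (x - s • vertical) r)) volume a b := by
  have hm : Measurable fun s : ℝ => ρ.real (Metric.ball (x - s • vertical) r) := by
    have hS : IsOpen {p : ℝ × E3 | dist p.2 (x - p.1 • vertical) < r} :=
      isOpen_lt (by fun_prop) continuous_const
    exact (measurable_measure_prodMk_left (ν := ρ) hS.measurableSet).ennreal_toReal
  refine (Measure.integrableOn_of_bounded (M := ρ.real Set.univ) ?_ hm.aestronglyMeasurable
    (Eventually.of_forall fun s => ?_)).intervalIntegrable
  · simp
  · rw [Real.norm_of_nonneg measureReal_nonneg]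
    exact measureReal_mono (Set.subset_univ _)

/-- Sweeping a small ball downwards through a finite measure sees its density on the wall. -/
theorem exists_ae_tendsto_swept_ball (ρ : Measure E3) [IsFiniteMeasure ρ] :
    ∃ D : E3 → ℝ, Integrable D wallMeasure ∧ ∀ᵐ x ∂wallMeasure,
      Tendsto (fun r : ℝ => (∫ s in (0 : ℝ)..r, ρ.real (Metric.ball (x - s • vertical) r)) / r ^ 3)
        (𝓝[>] 0) (𝓝 (D x)) := by
  -- The part `ρ₂` off the wall is singular to the area, so it contributes `o(r²)` per ball at
  -- almost every wall point. Only `ρ₁` is seen in the limit.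
  set ρ₁ := ρ.restrict wall with hρ₁
  set ρ₂ := ρ.restrict wallᶜ with hρ₂
  have hsing : ρ₂ ⟂ₘ wallMeasure := by
    refine ⟨wall, isClosed_wall.measurableSet, ?_, ?_⟩
    · rw [hρ₂, Measure.restrict_apply isClosed_wall.measurableSet]
      simp
    · rw [wallMeasure, Measure.restrict_apply isClosed_wall.measurableSet.compl]
      simp
  -- The factor `2 / 3` is the integral of `1 - s²` over `[0, 1]`.
  refine ⟨fun x => 2 / 3 * (discArea * (ρ₁.rnDeriv wallMeasure x).toReal),
    (Measure.integrable_toReal_rnDeriv.const_mul _).const_mul _, ?_⟩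
  filter_upwards [ae_tendsto_closedBall_div ρ₁, ae_tendsto_closedBall_div ρ₂,
    hsing.rnDeriv_ae_eq_zero, ae_mem_wall] with x h1 h2 hz hx
  rw [hz] at h2
  simp only [Pi.zero_apply, ENNReal.toReal_zero, mul_zero] at h2
  set a := discArea * (ρ₁.rnDeriv wallMeasure x).toReal with ha
  rw [Metric.tendsto_nhds] at h1 h2 ⊢
  intro ε hε
  have h1' := h1 (ε / 8) (by positivity)
  have h2' := h2 (ε / 8) (by positivity)
  rw [eventually_nhdsWithin_iff, Metric.eventually_nhds_iff] at h1' h2'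
  obtain ⟨δ₁, hδ₁, H₁⟩ := h1'
  obtain ⟨δ₂, hδ₂, H₂⟩ := h2'
  have hcl : ∀ R, 0 < R → R < δ₁ →
      |ρ₁.real (Metric.closedBall x R) - a * R ^ 2| ≤ ε / 8 * R ^ 2 := by
    intro R hR hR1
    have := (H₁ (y := R) (by simpa [abs_of_pos hR] using hR1) hR).le
    rw [Real.dist_eq] at this
    have hR2 : 0 < R ^ 2 := by positivity
    rw [← mul_le_mul_iff_left₀ hR2] at this
    refine le_trans (le_of_eq ?_) this
    rw [← abs_of_pos hR2, ← abs_mul, abs_of_pos hR2]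
    congr 1
    field_simp
  filter_upwards [Ioo_mem_nhdsGT (lt_min hδ₁ (half_pos hδ₂))] with r hr
  have hr0 : 0 < r := hr.1
  have hr1 : r < δ₁ := hr.2.trans_le (min_le_left _ _)
  have hr2 : 2 * r < δ₂ := by linarith [hr.2.trans_le (min_le_right _ _)]
  -- Every lowered ball lies in this one, and `ε / 8 * (2 * r) ^ 2 = ε / 2 * r ^ 2`. With `ε / 8`
  -- from `ρ₁` the total error is `5 / 8 * ε < ε`.
  have hρ₂r : ρ₂.real (Metric.closedBall x (2 * r)) ≤ ε / 2 * r ^ 2 := by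
    have := (H₂ (y := 2 * r) (by simpa [abs_of_pos hr0] using hr2) (by simpa using hr0)).le
    rw [Real.dist_eq, sub_zero, abs_of_nonneg (by positivity), div_le_iff₀ (by positivity)] at this
    nlinarith
  have hpt : ∀ s ∈ Set.uIoc 0 r,
      ‖ρ.real (Metric.ball (x - s • vertical) r) - a * (r ^ 2 - s ^ 2)‖ ≤ 5 / 8 * ε * r ^ 2 := by
    intro s hs
    rw [Set.uIoc_of_le hr0.le] at hs
    have hsplit : ρ.real (Metric.ball (x - s • vertical) r) =
        ρ₁.real (Metric.ball x (√(r ^ 2 - s ^ 2))) +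
          ρ₂.real (Metric.ball (x - s • vertical) r) := by
      rw [hρ₁, hρ₂, measureReal_restrict_apply Metric.isOpen_ball.measurableSet,
        measureReal_restrict_apply Metric.isOpen_ball.measurableSet,
        ← inter_wall_ball_sub hx ⟨hs.1.le, hs.2⟩, ← Set.sdiff_eq,
        measureReal_inter_add_sdiff isClosed_wall.measurableSet]
    have hb2 : ρ₂.real (Metric.ball (x - s • vertical) r) ≤ ε / 2 * r ^ 2 := by
      refine (measureReal_mono ?_).trans hρ₂r
      refine Metric.ball_subset_closedBall.trans (Metric.closedBall_subset_closedBall' ?_)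
      rw [dist_eq_norm, sub_sub_cancel_left, norm_neg, norm_smul, norm_vertical, mul_one,
        Real.norm_of_nonneg hs.1.le]
      linarith [hs.2]
    have hb1 : |ρ₁.real (Metric.ball x (√(r ^ 2 - s ^ 2))) - a * (r ^ 2 - s ^ 2)| ≤
        ε / 8 * r ^ 2 := by
      have hnn : 0 ≤ r ^ 2 - s ^ 2 := by nlinarith [hs.1, hs.2]
      have hsq := Real.sq_sqrt hnn
      rcases (Real.sqrt_nonneg (r ^ 2 - s ^ 2)).eq_or_lt with h0 | h0
      · rw [← h0] at hsq
        rw [← h0, ← hsq]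
        simp
        positivity
      · have hlt : √(r ^ 2 - s ^ 2) < δ₁ := by
          refine lt_of_le_of_lt ?_ hr1
          rw [Real.sqrt_le_left hr0.le]
          nlinarith
        have := ball_estimate_of_closedBall hcl h0 hlt
        rw [hsq] at this
        refine this.trans (mul_le_mul_of_nonneg_left ?_ (by positivity))
        nlinarith
    have hnn2 : 0 ≤ ρ₂.real (Metric.ball (x - s • vertical) r) := measureReal_nonneg
    rw [hsplit, Real.norm_eq_abs, abs_le]
    have := abs_le.1 hb1
    constructor <;> nlinarith [this.1, this.2]
  have hint := intervalIntegral.norm_integral_le_of_norm_le_const hpt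
  have hcont : IntervalIntegrable (fun s : ℝ => a * (r ^ 2 - s ^ 2)) volume 0 r :=
    (by fun_prop : Continuous fun s : ℝ => a * (r ^ 2 - s ^ 2)).intervalIntegrable _ _
  rw [intervalIntegral.integral_sub (intervalIntegrable_measure_ball ρ x r 0 r) hcont] at hint
  have hval : ∫ s in (0 : ℝ)..r, a * (r ^ 2 - s ^ 2) = 2 / 3 * a * r ^ 3 := by
    rw [intervalIntegral.integral_const_mul, intervalIntegral.integral_sub
      (by simp) (by simp), integral_pow, intervalIntegral.integral_const]
    simp only [smul_eq_mul]
    push_cast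
    ring
  rw [hval, Real.norm_eq_abs, sub_zero, abs_of_pos hr0] at hint
  have hr3 : 0 < r ^ 3 := by positivity
  rw [Real.dist_eq, ← mul_lt_mul_iff_left₀ hr3]
  have : |(∫ s in (0 : ℝ)..r, ρ.real (Metric.ball (x - s • vertical) r)) / r ^ 3 - 2 / 3 * a| *
      r ^ 3 = |(∫ s in (0 : ℝ)..r, ρ.real (Metric.ball (x - s • vertical) r)) -
        2 / 3 * a * r ^ 3| := by
    rw [← abs_of_pos hr3, ← abs_mul, abs_of_pos hr3]
    congr 1
    field_simp
  rw [this]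
  refine hint.trans_lt ?_
  nlinarith

end Wall

/-! ### Existence and integrability of the trace. -/

section Trace

variable {E : Set E3}

/-- The volume of `E` in a ball centred on the wall, through the vertical derivative of `E`. -/
theorem volume_inter_ball_eq_integral (hE : IsFinitePerimeterSet E) {μ ν : Measure E3}
    [IsFiniteMeasure μ] [IsFiniteMeasure ν]
    (h : ∀ g : E3 → ℝ, ContDiff ℝ 1 g → HasCompactSupport g →
      ∫ x in E, fderiv ℝ g x vertical = ∫ x, g x ∂μ - ∫ x, g x ∂ν)
    {x : E3} (hx : x ∈ wall) {r : ℝ} (hr : 0 < r) :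
    volume.real (E ∩ Metric.ball x r) =
      (∫ s in (0 : ℝ)..r, ν.real (Metric.ball (x - s • vertical) r)) -
        ∫ s in (0 : ℝ)..r, μ.real (Metric.ball (x - s • vertical) r) := by
  have hx' : x 2 = 0 := hx
  have hcont : ∀ (ρ : Measure E3) [IsFiniteMeasure ρ] (w : E3 → ℝ), Continuous w →
      (∀ y, |w y| ≤ 1) → Continuous fun s : ℝ => ∫ y, w (y + s • vertical) ∂ρ := by
    intro ρ _ w hw h1
    refine continuous_of_dominated (bound := fun _ => 1) (fun s => ?_)
      (fun s => Eventually.of_forall fun y => h1 _) (integrable_const _)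
      (Eventually.of_forall fun y => ?_)
    · exact (hw.comp (by fun_prop)).aestronglyMeasurable
    · exact hw.comp (by fun_prop)
  -- Lowering `w` by `r` pushes its support below the wall, away from `E`. The fundamental theorem
  -- of calculus along this motion expresses the integral of `w` through the vertical derivative of
  -- `E`.
  have key : ∀ w : E3 → ℝ, ContDiff ℝ 1 w → HasCompactSupport w →
      tsupport w ⊆ Metric.ball x r → (∀ y, |w y| ≤ 1) →
      ∫ y in E, w y = ∫ s in (0 : ℝ)..r, (∫ y, w (y + s • vertical) ∂ν -
        ∫ y, w (y + s • vertical) ∂μ) := by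
    intro w hw hc hs h1
    have hder : ∀ s ∈ Set.uIcc 0 r, HasDerivAt (fun s : ℝ => ∫ y in E, w (y + s • vertical))
        (∫ y, w (y + s • vertical) ∂μ - ∫ y, w (y + s • vertical) ∂ν) s := by
      intro s _
      have h2 := hasDerivAt_integral_translate hE.volume_ne_top hw hc vertical s
      have h3 := h (fun y => w (y + s • vertical)) (hw.comp (contDiff_id.add contDiff_const))
        (hc.comp_homeomorph (Homeomorph.addRight (s • vertical)))
      simp_rw [fderiv_comp_add_right] at h3
      rwa [h3] at h2
    have hc1 := hcont μ w hw.continuous h1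
    have hc2 := hcont ν w hw.continuous h1
    have hftc := intervalIntegral.integral_eq_sub_of_hasDerivAt hder
      ((hc1.sub hc2).intervalIntegrable _ _)
    have hzero : ∫ y in E, w (y + r • vertical) = 0 := by
      refine setIntegral_eq_zero_of_forall_eq_zero fun y hy => ?_
      refine image_eq_zero_of_notMem_tsupport fun hmem => ?_
      have h4 := hs hmem
      rw [Metric.mem_ball, dist_eq_norm] at h4
      have h5 : 0 < y 2 := hE.subset hy
      have h6 := PiLp.norm_apply_le (y + r • vertical - x) 2
      have h7 : (y + r • vertical - x) 2 = y 2 + r := by simp [vertical, hx']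
      rw [h7, Real.norm_of_nonneg (by linarith)] at h6
      linarith
    rw [hzero] at hftc
    simp only [zero_smul, add_zero, zero_sub] at hftc
    rw [← neg_inj, ← hftc, ← intervalIntegral.integral_neg]
    simp only [neg_sub]
  obtain ⟨w, hw, hc, hs, h1, hl⟩ := exists_smooth_approximation_ball x hr
  have hfin : IsFiniteMeasure (volume.restrict E) :=
    ⟨by simpa using hE.volume_ne_top.lt_top⟩
  have l1 : Tendsto (fun n => ∫ y in E, w n y) atTop
      (𝓝 (∫ y in E, (Metric.ball x r).indicator (1 : E3 → ℝ) y)) :=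
    tendsto_integral_of_dominated_convergence (fun _ => 1)
      (fun n => (hw n).continuous.aestronglyMeasurable) (integrable_const _)
      (fun n => Eventually.of_forall (h1 n)) (Eventually.of_forall hl)
  have hpt : ∀ (ρ : Measure E3) [IsFiniteMeasure ρ] (s : ℝ),
      Tendsto (fun n => ∫ y, w n (y + s • vertical) ∂ρ) atTop
        (𝓝 (ρ.real (Metric.ball (x - s • vertical) r))) := by
    intro ρ _ s
    have e : ρ.real (Metric.ball (x - s • vertical) r) =
        ∫ y, (Metric.ball x r).indicator (1 : E3 → ℝ) (y + s • vertical) ∂ρ := by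
      rw [← integral_indicator_one Metric.isOpen_ball.measurableSet]
      congr 1
      ext y
      have : y + s • vertical ∈ Metric.ball x r ↔ y ∈ Metric.ball (x - s • vertical) r := by
        rw [Metric.mem_ball, Metric.mem_ball, dist_eq_norm, dist_eq_norm,
          show y + s • vertical - x = y - (x - s • vertical) by abel]
      by_cases hy : y ∈ Metric.ball (x - s • vertical) r
      · rw [Set.indicator_of_mem hy, Set.indicator_of_mem (this.2 hy)]; rfl
      · rw [Set.indicator_of_notMem hy, Set.indicator_of_notMem fun h => hy (this.1 h)]
    rw [e]
    refine tendsto_integral_of_dominated_convergence (fun _ => 1) (fun n => ?_)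
      (integrable_const _) (fun n => Eventually.of_forall fun y => h1 n _)
      (Eventually.of_forall fun y => hl _)
    exact ((hw n).continuous.comp (by fun_prop)).aestronglyMeasurable
  have hbd : ∀ (ρ : Measure E3) [IsFiniteMeasure ρ] (n : ℕ) (s : ℝ),
      ‖∫ y, w n (y + s • vertical) ∂ρ‖ ≤ ρ.real Set.univ := by
    intro ρ _ n s
    have := norm_integral_le_of_norm_le_const (μ := ρ) (C := 1)
      (f := fun y => w n (y + s • vertical)) (Eventually.of_forall fun y => h1 n _)
    simpa using this
  have l2 : Tendsto (fun n => ∫ s in (0 : ℝ)..r, (∫ y, w n (y + s • vertical) ∂ν -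
        ∫ y, w n (y + s • vertical) ∂μ)) atTop
      (𝓝 (∫ s in (0 : ℝ)..r, (ν.real (Metric.ball (x - s • vertical) r) -
        μ.real (Metric.ball (x - s • vertical) r)))) := by
    refine intervalIntegral.tendsto_integral_filter_of_dominated_convergence
      (fun _ => ν.real Set.univ + μ.real Set.univ) (Eventually.of_forall fun n => ?_)
      (Eventually.of_forall fun n => Eventually.of_forall fun s _ => ?_) (by simp)
      (Eventually.of_forall fun s _ => (hpt ν s).sub (hpt μ s))
    · exact ((hcont ν _ (hw n).continuous (h1 n)).sub
        (hcont μ _ (hw n).continuous (h1 n))).aestronglyMeasurable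
    · exact (norm_sub_le _ _).trans (add_le_add (hbd ν n s) (hbd μ n s))
  have e := tendsto_nhds_unique l1
    (l2.congr fun n => (key _ (hw n) (hc n) (hs n) (h1 n)).symm)
  rw [setIntegral_indicator_ball] at e
  rw [e, intervalIntegral.integral_sub (intervalIntegrable_measure_ball ν x r 0 r)
    (intervalIntegrable_measure_ball μ x r 0 r)]

/-- The ratio whose limit is the trace. -/
def halfBallRatio (E : Set E3) (x : E3) (r : ℝ) : ℝ :=
  volume.real (E ∩ Metric.ball x r) / volume.real (halfSpace ∩ Metric.ball x r)

/-- The trace exists almost everywhere on the wall and is integrable. -/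
theorem IsFinitePerimeterSet.trace_spec (hE : IsFinitePerimeterSet E) :
    Integrable (trace E) wallMeasure ∧ ∀ᵐ x ∂wallMeasure,
      Tendsto (halfBallRatio E x) (𝓝[>] 0) (𝓝 (trace E x)) := by
  obtain ⟨μ, ν, hμ, hν, h⟩ := hE.exists_derivative_measures 2
  obtain ⟨Dμ, hDμ, htμ⟩ := exists_ae_tendsto_swept_ball μ
  obtain ⟨Dν, hDν, htν⟩ := exists_ae_tendsto_swept_ball ν
  set a := volume.real (halfSpace ∩ Metric.ball (0 : E3) 1) with ha
  have ha0 : 0 < a := volume_halfBall_pos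
  -- The swept integrals and the volume of the half-ball both scale like `r ^ 3`.
  have hlim : ∀ᵐ x ∂wallMeasure,
      Tendsto (halfBallRatio E x) (𝓝[>] 0) (𝓝 ((Dν x - Dμ x) / a)) := by
    filter_upwards [htμ, htν, ae_mem_wall] with x h1 h2 hx
    refine ((h2.sub h1).div_const a).congr' ?_
    filter_upwards [self_mem_nhdsWithin] with r hr
    have hr : 0 < r := hr
    rw [halfBallRatio, volume_inter_ball_eq_integral hE h hx hr, volume_halfSpace_inter_ball hx hr,
      ← ha]
    field_simp
  have htr : ∀ᵐ x ∂wallMeasure, trace E x = (Dν x - Dμ x) / a :=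
    hlim.mono fun x hx => hx.limUnder_eq
  refine ⟨(((hDν.sub hDμ).div_const a).congr ?_), ?_⟩
  · filter_upwards [htr] with x hx
    rw [hx]
    rfl
  · filter_upwards [hlim, htr] with x h1 h2
    rwa [h2]

end Trace

/-! ### Density-one representatives. -/

section Density

variable {A B : Set E3}

theorem densityOne_congr_ae (h : A =ᵐ[volume] B) : densityOne A = densityOne B := by
  ext x
  have : ∀ r : ℝ, volume (A ∩ Metric.ball x r) = volume (B ∩ Metric.ball x r) := fun r =>
    measure_congr (h.inter (ae_eq_refl _))
  change Tendsto _ _ _ ↔ Tendsto _ _ _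
  simp only [this]

theorem ball_ae_eq_closedBall (x : E3) {r : ℝ} (hr : r ≠ 0) :
    (Metric.ball x r : Set E3) =ᵐ[volume] Metric.closedBall x r := by
  rw [← Metric.ball_union_sphere]
  exact (union_ae_eq_left_of_ae_eq_empty
    (ae_eq_empty.2 (Measure.addHaar_sphere_of_ne_zero volume x hr))).symm

/-- Lebesgue's density theorem. -/
theorem densityOne_ae_eq (hA : MeasurableSet A) : densityOne A =ᵐ[volume] A := by
  filter_upwards [Besicovitch.ae_tendsto_measure_inter_div_of_measurableSet volume hA] with x hx
  have h : Tendsto (fun r : ℝ => volume (A ∩ Metric.ball x r) / volume (Metric.ball x r))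
      (𝓝[>] 0) (𝓝 (A.indicator 1 x)) := by
    refine hx.congr' ?_
    filter_upwards [self_mem_nhdsWithin] with r hr
    have e := ball_ae_eq_closedBall x (ne_of_gt hr : r ≠ 0)
    rw [measure_congr e, measure_congr ((ae_eq_refl A).inter e)]
  refine propext (Iff.trans (b := A.indicator (1 : E3 → ENNReal) x = 1) ⟨fun h' => ?_, fun h' => ?_⟩
    ?_)
  · exact tendsto_nhds_unique h h'
  · change Tendsto _ _ _
    rwa [h'] at h
  · change _ ↔ x ∈ A
    by_cases hxA : x ∈ A <;> simp [hxA]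

theorem ratio_le_one (A : Set E3) (x : E3) (r : ℝ) :
    volume (A ∩ Metric.ball x r) / volume (Metric.ball x r) ≤ 1 :=
  ENNReal.div_le_of_le_mul (by rw [one_mul]; exact measure_mono Set.inter_subset_right)

theorem densityOne_mono (h : A ⊆ B) : densityOne A ⊆ densityOne B := by
  intro x hx
  refine tendsto_of_tendsto_of_tendsto_of_le_of_le hx tendsto_const_nhds (fun r => ?_)
    fun r => ratio_le_one B x r
  exact ENNReal.div_le_div_right (measure_mono (Set.inter_subset_inter_left _ h)) _

/-- Densities of disjoint sets add up to at most one. -/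
theorem densityOne_disjoint (hB : MeasurableSet B) (h : Disjoint A B) {x : E3}
    (hA' : x ∈ densityOne A) : x ∉ densityOne B := by
  intro hB'
  have hA'' : Tendsto _ _ _ := hA'
  have hlim := Tendsto.add hA'' hB'
  have hle : (1 : ENNReal) + 1 ≤ 1 := by
    refine le_of_tendsto hlim (Eventually.of_forall fun r => ?_)
    rw [← ENNReal.add_div, ← measure_union (h.mono Set.inter_subset_left Set.inter_subset_left)
      (hB.inter Metric.isOpen_ball.measurableSet), ← Set.union_inter_distrib_right]
    exact ratio_le_one _ x r
  norm_num at hle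

/-- At a point `x` on or below the wall, the point reflection through `x` maps `A` to a disjoint set
with the same density at `x`, so that density cannot be one. -/
theorem densityOne_subset_halfSpace (hA : MeasurableSet A) (h : A ⊆ halfSpace) :
    densityOne A ⊆ halfSpace := by
  intro x hx
  by_contra hxΩ
  have hx2 : x 2 ≤ 0 := not_lt.1 hxΩ
  have hmeas : MeasurableSet ((fun y => (x + x) - y) ⁻¹' A) :=
    hA.preimage (measurable_const.sub measurable_id)
  refine densityOne_disjoint hmeas ?_ hx (B := (fun y => (x + x) - y) ⁻¹' A) ?_
  · rw [Set.disjoint_left]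
    intro y hy hy'
    have h1 : 0 < y 2 := h hy
    have h2 : 0 < (x + x - y) 2 := h hy'
    simp only [PiLp.sub_apply, PiLp.add_apply] at h2
    linarith
  · have hx' : Tendsto _ _ _ := hx
    refine Tendsto.congr (f₁ := _) (fun r => ?_) hx'
    congr 1
    rw [← (Measure.measurePreserving_sub_left (volume : Measure E3) (x + x)).measure_preimage
      (hA.inter Metric.isOpen_ball.measurableSet).nullMeasurableSet, Set.preimage_inter]
    congr 2
    ext y
    rw [Set.mem_preimage, Metric.mem_ball, Metric.mem_ball, dist_eq_norm, dist_eq_norm,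
      show x + x - y - x = -(y - x) by abel, norm_neg]

theorem measurable_ratio (hA : MeasurableSet A) (r : ℝ) :
    Measurable fun x => volume (A ∩ Metric.ball x r) / volume (Metric.ball x r) := by
  have hS : ∀ {C : Set E3}, MeasurableSet C → Measurable fun x => volume (C ∩ Metric.ball x r) := by
    intro C hC
    have hd : IsOpen {p : E3 × E3 | dist p.2 p.1 < r} :=
      isOpen_lt (continuous_snd.dist continuous_fst) continuous_const
    have : MeasurableSet {p : E3 × E3 | p.2 ∈ C ∧ dist p.2 p.1 < r} :=
      (measurable_snd hC).inter hd.measurableSet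
    exact measurable_measure_prodMk_left (ν := volume) this
  refine (hS hA).div ?_
  simp

/-- A countable description, needed for measurability. Rational radii suffice: approximating `r`
from below, the volume of the ball is continuous and that of its intersection with `A` is monotone.
-/
theorem mem_densityOne_iff {x : E3} :
    x ∈ densityOne A ↔ ∀ n : ℕ, ∃ k : ℕ, ∀ q : ℚ, (0 : ℝ) < q → (q : ℝ) < 1 / ((k : ℝ) + 1) →
      1 - (n + 1 : ENNReal)⁻¹ ≤
        volume (A ∩ Metric.ball x q) / volume (Metric.ball x q) := by
  constructor
  · intro hx n
    have hx' : Tendsto _ _ _ := hx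
    have hlt : 1 - (n + 1 : ENNReal)⁻¹ < 1 :=
      ENNReal.sub_lt_self (by simp) one_ne_zero (by simp)
    have := hx'.eventually (lt_mem_nhds hlt)
    rw [eventually_nhdsWithin_iff, Metric.eventually_nhds_iff] at this
    obtain ⟨δ, hδ, H⟩ := this
    obtain ⟨k, hk⟩ := exists_nat_one_div_lt hδ
    exact ⟨k, fun q hq hqk => (H (by rw [dist_zero_right, Real.norm_of_nonneg hq.le]; exact hqk.trans hk) hq).le⟩
  · intro H
    refine tendsto_order.2 ⟨fun a ha => ?_, fun a ha => Eventually.of_forall fun r =>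
      (ratio_le_one A x r).trans_lt ha⟩
    have hl : Tendsto (fun n : ℕ => 1 - (n + 1 : ENNReal)⁻¹) atTop (𝓝 1) := by
      have h1 : Tendsto (fun n : ℕ => ((n : ENNReal) + 1)⁻¹) atTop (𝓝 0) := by
        have := ENNReal.tendsto_inv_nat_nhds_zero.comp (tendsto_add_atTop_nat 1)
        refine this.congr fun n => ?_
        simp
      have := ENNReal.Tendsto.sub (tendsto_const_nhds (x := (1 : ENNReal)) (f := atTop)) h1
        (Or.inl ENNReal.one_ne_top)
      simpa using this
    obtain ⟨n, hn⟩ := (hl.eventually (lt_mem_nhds ha)).exists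
    obtain ⟨k, hk⟩ := H n
    filter_upwards [Ioo_mem_nhdsGT (show (0 : ℝ) < 1 / ((k : ℝ) + 1) by positivity)] with r hr
    refine hn.trans_le ?_
    have hpos : volume (Metric.ball x r) ≠ 0 := (Metric.measure_ball_pos volume x hr.1).ne'
    have hfin : volume (Metric.ball x r) ≠ ⊤ := Metric.isBounded_ball.measure_lt_top.ne
    rw [ENNReal.le_div_iff_mul_le (Or.inl hpos) (Or.inl hfin)]
    set c := 1 - (n + 1 : ENNReal)⁻¹
    have hc : c ≠ ⊤ := ne_top_of_le_ne_top ENNReal.one_ne_top tsub_le_self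
    have hV : ∀ s : ℝ, 0 < s → c * volume (Metric.ball x s) =
        c * (ENNReal.ofReal (s ^ 3) * volume (Metric.ball (0 : E3) 1)) := fun s hs => by
      rw [Measure.addHaar_ball_of_pos volume x hs, finrank_euclideanSpace, Fintype.card_fin]
    rw [hV r hr.1]
    have hlim : Tendsto (fun s : ℝ => c * (ENNReal.ofReal (s ^ 3) *
        volume (Metric.ball (0 : E3) 1))) (𝓝[<] r)
        (𝓝 (c * (ENNReal.ofReal (r ^ 3) * volume (Metric.ball (0 : E3) 1)))) := by
      refine ENNReal.Tendsto.const_mul (ENNReal.Tendsto.mul_const ?_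
        (Or.inr Metric.isBounded_ball.measure_lt_top.ne)) (Or.inr hc)
      exact (ENNReal.continuous_ofReal.comp (continuous_pow 3)).continuousAt.mono_left
        nhdsWithin_le_nhds
    refine le_of_tendsto_of_frequently hlim ?_
    rw [frequently_iff]
    intro U hU
    obtain ⟨l, hl, hlU⟩ := (mem_nhdsLT_iff_exists_Ioo_subset' hr.1).1 hU
    obtain ⟨q, hq1, hq2⟩ := exists_rat_btwn (max_lt hl hr.1 : max l 0 < r)
    have hq0 : (0 : ℝ) < q := (le_max_right _ _).trans_lt hq1
    refine ⟨q, hlU ⟨(le_max_left _ _).trans_lt hq1, hq2⟩, ?_⟩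
    have := hk q hq0 (hq2.trans hr.2)
    rw [ENNReal.le_div_iff_mul_le (Or.inl (Metric.measure_ball_pos volume x hq0).ne')
      (Or.inl Metric.isBounded_ball.measure_lt_top.ne)] at this
    rw [← hV q hq0]
    exact this.trans (measure_mono (Set.inter_subset_inter_right _ (Metric.ball_subset_ball hq2.le)))

theorem measurableSet_densityOne (hA : MeasurableSet A) : MeasurableSet (densityOne A) := by
  have : densityOne A = ⋂ n : ℕ, ⋃ k : ℕ, ⋂ q : ℚ, ⋂ _ : (0 : ℝ) < q,
      ⋂ _ : (q : ℝ) < 1 / ((k : ℝ) + 1), {x | 1 - (n + 1 : ENNReal)⁻¹ ≤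
        volume (A ∩ Metric.ball x q) / volume (Metric.ball x q)} := by
    ext x
    rw [mem_densityOne_iff]
    simp
  rw [this]
  exact MeasurableSet.iInter fun n => MeasurableSet.iUnion fun k => MeasurableSet.iInter fun q =>
    MeasurableSet.iInter fun _ => MeasurableSet.iInter fun _ =>
      measurableSet_le measurable_const (measurable_ratio hA q)

/-- Passing to the points of density one yields a representative in `BV(Ω; {0,1})`. -/
theorem IsFinitePerimeterSet.isBVSet_densityOne (h : IsFinitePerimeterSet A) :
    IsBVSet (densityOne A) := by
  have e := densityOne_ae_eq h.measurableSet
  exact ⟨measurableSet_densityOne h.measurableSet,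
    densityOne_subset_halfSpace h.measurableSet h.subset,
    by rw [measure_congr e]; exact h.volume_ne_top.lt_top,
    by rw [perimeter_congr_ae e]; exact h.perimeter_ne_top.lt_top, densityOne_congr_ae e⟩

theorem atw_congr_ae (h : A =ᵐ[volume] B) (β : E3 → ℝ) (E₀ : Set E3) (τ : ℝ) :
    atw β A E₀ τ = atw β B E₀ τ := by
  have ht : trace A = trace B := by
    ext x
    have : ∀ r : ℝ, volume.real (A ∩ Metric.ball x r) = volume.real (B ∩ Metric.ball x r) :=
      fun r => measureReal_congr (h.inter (ae_eq_refl _))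
    simp only [trace, this]
  rw [atw, atw, capillary, capillary, perimeter_congr_ae h, ht,
    setLIntegral_congr (h.symmDiff (ae_eq_refl E₀))]

end Density

/-! ### Finite perimeter of unions, intersections and differences. -/

section SetOperations

variable {E F : Set E3}

theorem IsFinitePerimeterSet.perimeter_union_inter (hE : IsFinitePerimeterSet E)
    (hF : IsFinitePerimeterSet F) :
    perimeter (E ∪ F) halfSpace + perimeter (E ∩ F) halfSpace ≤
      perimeter E halfSpace + perimeter F halfSpace :=
  perimeter_union_add_perimeter_inter_le hE.measurableSet hF.measurableSet isOpen_halfSpace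

/-- Submodularity for `E` and `Fᶜ`: their intersection is `E \ F` and the complement of their union
is `F \ E`. -/
theorem IsFinitePerimeterSet.perimeter_diff_diff (hE : IsFinitePerimeterSet E)
    (hF : IsFinitePerimeterSet F) :
    perimeter (E \ F) halfSpace + perimeter (F \ E) halfSpace ≤
      perimeter E halfSpace + perimeter F halfSpace := by
  have h := perimeter_union_add_perimeter_inter_le hE.measurableSet hF.measurableSet.compl
    isOpen_halfSpace
  rw [perimeter_compl hF.measurableSet, ← perimeter_compl (hE.measurableSet.union
    hF.measurableSet.compl), Set.compl_union, compl_compl, add_comm] at h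
  rwa [Set.sdiff_eq, Set.sdiff_eq, Set.inter_comm F]

theorem IsFinitePerimeterSet.of_perimeter_le {A B : Set E3} (hE : IsFinitePerimeterSet E)
    (hF : IsFinitePerimeterSet F) (hA : MeasurableSet A) (hsub : A ⊆ E ∪ F)
    (hP : perimeter A halfSpace + perimeter B halfSpace ≤
      perimeter E halfSpace + perimeter F halfSpace) : IsFinitePerimeterSet A := by
  refine ⟨hA, hsub.trans (Set.union_subset hE.subset hF.subset), ?_, ?_⟩
  · exact ne_top_of_le_ne_top (ENNReal.add_ne_top.2 ⟨hE.volume_ne_top, hF.volume_ne_top⟩)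
      ((measure_mono hsub).trans (measure_union_le _ _))
  · exact ne_top_of_le_ne_top (ENNReal.add_ne_top.2 ⟨hE.perimeter_ne_top, hF.perimeter_ne_top⟩)
      (le_self_add.trans hP)

theorem IsFinitePerimeterSet.union_inter (hE : IsFinitePerimeterSet E)
    (hF : IsFinitePerimeterSet F) :
    IsFinitePerimeterSet (E ∪ F) ∧ IsFinitePerimeterSet (E ∩ F) := by
  have h := hE.perimeter_union_inter hF
  refine ⟨hE.of_perimeter_le hF (hE.measurableSet.union hF.measurableSet) le_rfl h,
    hE.of_perimeter_le hF (hE.measurableSet.inter hF.measurableSet)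
      (Set.inter_subset_left.trans Set.subset_union_left) ((add_comm _ _).trans_le h)⟩

theorem IsFinitePerimeterSet.diff_diff (hE : IsFinitePerimeterSet E)
    (hF : IsFinitePerimeterSet F) :
    IsFinitePerimeterSet (E \ F) ∧ IsFinitePerimeterSet (F \ E) := by
  have h := hE.perimeter_diff_diff hF
  refine ⟨hE.of_perimeter_le hF (hE.measurableSet.diff hF.measurableSet)
      (Set.sdiff_subset.trans Set.subset_union_left) h,
    hE.of_perimeter_le hF (hF.measurableSet.diff hE.measurableSet)
      (Set.sdiff_subset.trans Set.subset_union_right) ((add_comm _ _).trans_le h)⟩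

end SetOperations

/-! ### The wall energy under the two exchanges. -/

section WallEnergy

variable {E F A B : Set E3} {β β₁ β₂ : E3 → ℝ}

theorem IsAdhesionCoefficient.integrable_mul_trace (hβ : IsAdhesionCoefficient β)
    (hE : IsFinitePerimeterSet E) : Integrable (fun x => β x * trace E x) wallMeasure :=
  hE.trace_spec.1.bdd_mul (c := (eLpNorm β ⊤ wallMeasure).toReal) hβ.1.1 (by
    have h := ae_le_eLpNormEssSup (f := β) (μ := wallMeasure)
    filter_upwards [h] with x hx
    rw [← eLpNorm_exponent_top] at hx
    have := ENNReal.toReal_mono hβ.1.2.ne hx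
    simpa using this)

theorem volume_inter_ball_ne_top (A : Set E3) (x : E3) (r : ℝ) :
    volume (A ∩ Metric.ball x r) ≠ ⊤ :=
  ne_top_of_le_ne_top Metric.isBounded_ball.measure_lt_top.ne (measure_mono Set.inter_subset_right)

theorem trace_mono_ae (hE : IsFinitePerimeterSet E) (hF : IsFinitePerimeterSet F) (h : E ⊆ F) :
    ∀ᵐ x ∂wallMeasure, trace E x ≤ trace F x := by
  filter_upwards [hE.trace_spec.2, hF.trace_spec.2] with x hx hy
  refine le_of_tendsto_of_tendsto' hx hy fun r => ?_
  exact div_le_div_of_nonneg_right (measureReal_mono (Set.inter_subset_inter_left _ h)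
    (volume_inter_ball_ne_top _ _ _)) measureReal_nonneg

/-- Traces are additive on disjoint unions. -/
theorem trace_add_ae (hE : IsFinitePerimeterSet E) (hF : IsFinitePerimeterSet F)
    (hA : IsFinitePerimeterSet A) (hd : Disjoint E F) (h : A = E ∪ F) :
    ∀ᵐ x ∂wallMeasure, trace A x = trace E x + trace F x := by
  filter_upwards [hE.trace_spec.2, hF.trace_spec.2, hA.trace_spec.2] with x hx hy hz
  refine tendsto_nhds_unique hz ((hx.add hy).congr fun r => ?_)
  rw [halfBallRatio, halfBallRatio, halfBallRatio, ← add_div, h, Set.union_inter_distrib_right,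
    measureReal_union (hd.mono Set.inter_subset_left Set.inter_subset_left)
      (hF.measurableSet.inter Metric.isOpen_ball.measurableSet)
      (volume_inter_ball_ne_top _ _ _) (volume_inter_ball_ne_top _ _ _)]

theorem integral_trace_add_le (hβ₁ : IsAdhesionCoefficient β₁) (hβ₂ : IsAdhesionCoefficient β₂)
    (hE : IsFinitePerimeterSet E) (hF : IsFinitePerimeterSet F) (hA : IsFinitePerimeterSet A)
    (hB : IsFinitePerimeterSet B)
    (h : ∀ᵐ x ∂wallMeasure, β₁ x * trace A x + β₂ x * trace B x ≤
      β₁ x * trace E x + β₂ x * trace F x) :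
    (∫ x, β₁ x * trace A x ∂wallMeasure) + ∫ x, β₂ x * trace B x ∂wallMeasure ≤
      (∫ x, β₁ x * trace E x ∂wallMeasure) + ∫ x, β₂ x * trace F x ∂wallMeasure := by
  rw [← integral_add (hβ₁.integrable_mul_trace hA) (hβ₂.integrable_mul_trace hB),
    ← integral_add (hβ₁.integrable_mul_trace hE) (hβ₂.integrable_mul_trace hF)]
  exact integral_mono_ae ((hβ₁.integrable_mul_trace hA).add (hβ₂.integrable_mul_trace hB))
    ((hβ₁.integrable_mul_trace hE).add (hβ₂.integrable_mul_trace hF)) h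

/-- The exchange moves the trace of `F \ E` from the coefficient `β₂` to the smaller `β₁`. -/
theorem wallEnergy_union_inter_le (hβ₁ : IsAdhesionCoefficient β₁)
    (hβ₂ : IsAdhesionCoefficient β₂) (hE : IsFinitePerimeterSet E) (hF : IsFinitePerimeterSet F)
    (hβ : ∀ᵐ x ∂wallMeasure, β₁ x ≤ β₂ x) :
    (∫ x, β₁ x * trace (E ∪ F) x ∂wallMeasure) + ∫ x, β₂ x * trace (E ∩ F) x ∂wallMeasure ≤
      (∫ x, β₁ x * trace E x ∂wallMeasure) + ∫ x, β₂ x * trace F x ∂wallMeasure := by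
  obtain ⟨hU, hI⟩ := hE.union_inter hF
  have hD := (hE.diff_diff hF).2
  refine integral_trace_add_le hβ₁ hβ₂ hE hF hU hI ?_
  have h1 := trace_add_ae hE hD hU Set.disjoint_sdiff_right (Set.union_sdiff_self).symm
  have h2 := trace_add_ae hI hD hF
    (Set.disjoint_sdiff_right.mono_left Set.inter_subset_left)
    (by rw [Set.inter_comm, Set.inter_union_sdiff])
  have h3 := trace_mono_ae hI hF Set.inter_subset_right
  filter_upwards [h1, h2, h3, hβ] with x e1 e2 e3 e4
  have e5 : 0 ≤ trace (F \ E) x := by linarith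
  rw [e1, e2]
  nlinarith [mul_nonneg (sub_nonneg.2 e4) e5]

/-- The trace of `E ∩ F` is removed from both sets, which saves `(β₁ + β₂) trace (E ∩ F)`. -/
theorem wallEnergy_diff_diff_le (hβ₁ : IsAdhesionCoefficient β₁)
    (hβ₂ : IsAdhesionCoefficient β₂) (hE : IsFinitePerimeterSet E) (hF : IsFinitePerimeterSet F)
    (hβ : ∀ᵐ x ∂wallMeasure, 0 ≤ β₁ x + β₂ x) :
    (∫ x, β₁ x * trace (E \ F) x ∂wallMeasure) + ∫ x, β₂ x * trace (F \ E) x ∂wallMeasure ≤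
      (∫ x, β₁ x * trace E x ∂wallMeasure) + ∫ x, β₂ x * trace F x ∂wallMeasure := by
  have hI := (hE.union_inter hF).2
  obtain ⟨hD, hD'⟩ := hE.diff_diff hF
  refine integral_trace_add_le hβ₁ hβ₂ hE hF hD hD' ?_
  have h1 := trace_add_ae hI hD hE
    (Set.disjoint_sdiff_right.mono_left Set.inter_subset_right) (Set.inter_union_sdiff E F).symm
  have h2 := trace_add_ae hI hD' hF
    (Set.disjoint_sdiff_right.mono_left Set.inter_subset_left)
    (by rw [Set.inter_comm, Set.inter_union_sdiff])
  have h3 := trace_mono_ae hD hE Set.sdiff_subset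
  filter_upwards [h1, h2, h3, hβ] with x e1 e2 e3 e4
  have e5 : 0 ≤ trace (E ∩ F) x := by linarith
  rw [e1, e2]
  nlinarith [mul_nonneg e4 e5]

end WallEnergy

/-! ### The dissipation under the two exchanges. -/

section Dissipation

variable {E F E₀ F₀ A B : Set E3}

/-- The dissipation `(1/τ) ∫_{E Δ E₀} d_{E₀}`. -/
def dissipation (E E₀ : Set E3) (τ : ℝ) : ENNReal :=
  ENNReal.ofReal (1 / τ) * ∫⁻ x in symmDiff E E₀, bdryDist E₀ x

theorem measurable_bdryDist (E : Set E3) : Measurable (bdryDist E) := by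
  unfold bdryDist
  exact measurable_infEDist

theorem dissipation_add_le (τ : ℝ) (hE : MeasurableSet E) (hF : MeasurableSet F)
    (hE₀ : MeasurableSet E₀) (hF₀ : MeasurableSet F₀) (hA : MeasurableSet A)
    (hB : MeasurableSet B)
    (h : ∀ x, (symmDiff A E₀).indicator (bdryDist E₀) x +
        (symmDiff B F₀).indicator (bdryDist F₀) x ≤
      (symmDiff E E₀).indicator (bdryDist E₀) x + (symmDiff F F₀).indicator (bdryDist F₀) x) :
    dissipation A E₀ τ + dissipation B F₀ τ ≤ dissipation E E₀ τ + dissipation F F₀ τ := by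
  have hm : ∀ {S T : Set E3}, MeasurableSet S → MeasurableSet T →
      Measurable ((symmDiff S T).indicator (bdryDist T)) := fun hS hT =>
    (measurable_bdryDist _).indicator (hS.symmDiff hT)
  rw [dissipation, dissipation, dissipation, dissipation, ← mul_add, ← mul_add,
    ← lintegral_indicator (hA.symmDiff hE₀), ← lintegral_indicator (hB.symmDiff hF₀),
    ← lintegral_indicator (hE.symmDiff hE₀), ← lintegral_indicator (hF.symmDiff hF₀),
    ← lintegral_add_left (hm hA hE₀), ← lintegral_add_left (hm hE hE₀)]
  exact mul_le_mul_right (lintegral_mono h) _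

/-- Only points of `F \ E` change sides. For those in both `E₀` and `F₀`, or in neither, the
ordering of the distances decides; those in `E₀ \ F₀` cost nothing after the exchange. -/
theorem indicator_symmDiff_union_inter_le (hF : F ⊆ halfSpace)
    (hE₀ : IsBVSet E₀) (hF₀ : IsBVSet F₀) (h : F₀ ⊆ E₀) (x : E3) :
    (symmDiff (E ∪ F) E₀).indicator (bdryDist E₀) x +
        (symmDiff (E ∩ F) F₀).indicator (bdryDist F₀) x ≤
      (symmDiff E E₀).indicator (bdryDist E₀) x + (symmDiff F F₀).indicator (bdryDist F₀) x := by
  classical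
  simp only [Set.indicator_apply, Set.mem_symmDiff, Set.mem_union, Set.mem_inter_iff]
  by_cases hxE : x ∈ E <;> by_cases hxF : x ∈ F <;> by_cases hxE₀ : x ∈ E₀ <;>
    by_cases hxF₀ : x ∈ F₀ <;> simp [hxE, hxF, hxE₀, hxF₀]
  · exact hF₀.bdryDist_le_of_subset_of_mem h hxF₀
  · exact absurd (h hxF₀) hxE₀
  · exact hE₀.bdryDist_le_of_subset h (hF hxF) hxE₀

/-- Only points of `E ∩ F` matter: removing one costs something only if it lies in `E₀` or `F₀`, and
then the distance to the boundary of the set containing it is the smaller one. -/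
theorem indicator_symmDiff_diff_diff_le (hE₀ : IsBVSet E₀) (hF₀ : IsBVSet F₀)
    (h : E₀ ∩ F₀ = ∅) (x : E3) :
    (symmDiff (E \ F) E₀).indicator (bdryDist E₀) x +
        (symmDiff (F \ E) F₀).indicator (bdryDist F₀) x ≤
      (symmDiff E E₀).indicator (bdryDist E₀) x + (symmDiff F F₀).indicator (bdryDist F₀) x := by
  classical
  have h' : F₀ ∩ E₀ = ∅ := by rw [Set.inter_comm, h]
  simp only [Set.indicator_apply, Set.mem_symmDiff, Set.mem_sdiff]
  by_cases hxE : x ∈ E <;> by_cases hxF : x ∈ F <;> by_cases hxE₀ : x ∈ E₀ <;>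
    by_cases hxF₀ : x ∈ F₀ <;> simp [hxE, hxF, hxE₀, hxF₀]
  · exact absurd (show x ∈ E₀ ∩ F₀ from ⟨hxE₀, hxF₀⟩) (h ▸ Set.notMem_empty x)
  · exact hE₀.bdryDist_le_of_disjoint h hxE₀ hF₀.subset
  · exact hF₀.bdryDist_le_of_disjoint h' hxF₀ hE₀.subset

end Dissipation

/-! ### The exchange argument. -/

section Comparison

variable {E F E₀ F₀ A B : Set E3} {β β₁ β₂ : E3 → ℝ} {τ : ℝ}

theorem capillary_eq_coe (hE : IsFinitePerimeterSet E) : capillary β E =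
    (((perimeter E halfSpace).toReal + ∫ x, β x * trace E x ∂wallMeasure : ℝ) : EReal) := by
  rw [capillary, EReal.coe_add, EReal.coe_ennreal_toReal hE.perimeter_ne_top]

theorem atw_eq_coe (hE : IsFinitePerimeterSet E) (hd : dissipation E E₀ τ ≠ ⊤) :
    atw β E E₀ τ = (((perimeter E halfSpace).toReal + (∫ x, β x * trace E x ∂wallMeasure) +
      (dissipation E E₀ τ).toReal : ℝ) : EReal) := by
  rw [atw, capillary_eq_coe hE, EReal.coe_add _ (dissipation E E₀ τ).toReal,
    EReal.coe_ennreal_toReal hd, dissipation]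

/-- `E₀` is itself a competitor, with zero dissipation. Finiteness allows the energies to be
compared by real arithmetic, although `bdryDist` may be infinite. -/
theorem IsMinimizer.dissipation_ne_top (hE₀ : IsBVSet E₀) (h : IsMinimizer β E₀ τ E) :
    dissipation E E₀ τ ≠ ⊤ := by
  intro htop
  have h1 := h.2 E₀ hE₀
  have h2 : dissipation E₀ E₀ τ ≠ ⊤ := by simp [dissipation]
  rw [atw_eq_coe hE₀.isFinitePerimeterSet h2, atw, capillary_eq_coe h.1.isFinitePerimeterSet] at h1
  change _ + ((dissipation E E₀ τ : ENNReal) : EReal) ≤ _ at h1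
  rw [htop, EReal.coe_ennreal_top, EReal.coe_add_top] at h1
  exact EReal.coe_ne_top _ (top_le_iff.1 h1)

/-- If exchanging `(E, F)` for `(A, B)` does not increase the total energy, `B` minimizes. -/
theorem IsMinimizer.of_exchange (hE₀ : IsBVSet E₀) (hF₀ : IsBVSet F₀)
    (hE : IsMinimizer β₁ E₀ τ E) (hF : IsMinimizer β₂ F₀ τ F) (hA : IsFinitePerimeterSet A)
    (hB : IsFinitePerimeterSet B)
    (hP : perimeter A halfSpace + perimeter B halfSpace ≤
      perimeter E halfSpace + perimeter F halfSpace)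
    (hT : (∫ x, β₁ x * trace A x ∂wallMeasure) + ∫ x, β₂ x * trace B x ∂wallMeasure ≤
      (∫ x, β₁ x * trace E x ∂wallMeasure) + ∫ x, β₂ x * trace F x ∂wallMeasure)
    (hD : dissipation A E₀ τ + dissipation B F₀ τ ≤ dissipation E E₀ τ + dissipation F F₀ τ) :
    IsMinimizer β₂ F₀ τ (densityOne B) := by
  have hEp := hE.1.isFinitePerimeterSet
  have hFp := hF.1.isFinitePerimeterSet
  have dE := hE.dissipation_ne_top hE₀
  have dF := hF.dissipation_ne_top hF₀
  have dsum := ne_top_of_le_ne_top (ENNReal.add_ne_top.2 ⟨dE, dF⟩) hD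
  obtain ⟨dA, dB⟩ := ENNReal.add_ne_top.1 dsum
  have hD' := ENNReal.toReal_mono (ENNReal.add_ne_top.2 ⟨dE, dF⟩) hD
  rw [ENNReal.toReal_add dA dB, ENNReal.toReal_add dE dF] at hD'
  have hP' := ENNReal.toReal_mono
    (ENNReal.add_ne_top.2 ⟨hEp.perimeter_ne_top, hFp.perimeter_ne_top⟩) hP
  rw [ENNReal.toReal_add hA.perimeter_ne_top hB.perimeter_ne_top,
    ENNReal.toReal_add hEp.perimeter_ne_top hFp.perimeter_ne_top] at hP'
  -- `A` costs at least as much as `E`; as the sum does not increase, `B` costs at most as much as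
  -- `F`. Competitors must be density-one sets, and `densityOne A` has the energy of `A`.
  have hmin := hE.2 _ hA.isBVSet_densityOne
  rw [atw_congr_ae (densityOne_ae_eq hA.measurableSet), atw_eq_coe hEp dE, atw_eq_coe hA dA,
    EReal.coe_le_coe_iff] at hmin
  refine ⟨hB.isBVSet_densityOne, fun G hG => le_trans ?_ (hF.2 G hG)⟩
  rw [atw_congr_ae (densityOne_ae_eq hB.measurableSet), atw_eq_coe hFp dF, atw_eq_coe hB dB,
    EReal.coe_le_coe_iff]
  linarith

end Comparison

end

end CapillaryDroplet

open CapillaryDroplet in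
theorem mainTheorem4 (E₀ F₀ : Set E3)
    (hE₀ : IsBVSet E₀) (hF₀ : IsBVSet F₀)
    (hE₀b : Bornology.IsBounded E₀) (hF₀b : Bornology.IsBounded F₀)
    (hE₀f : volume (frontier E₀) = 0) (hF₀f : volume (frontier F₀) = 0)
    (β₁ β₂ : E3 → ℝ)
    (hβ₁ : IsAdhesionCoefficient β₁) (hβ₂ : IsAdhesionCoefficient β₂)
    (τ : ℝ) (hτ : 0 < τ) (E F : Set E3)
    (hE : IsMinimizer β₁ E₀ τ E) (hF : IsMinimalMinimizer β₂ F₀ τ F) :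
    (F₀ ⊆ E₀ → (∀ᵐ x ∂wallMeasure, β₁ x ≤ β₂ x) → F ⊆ E) ∧
    (E₀ ∩ F₀ = ∅ → (∀ᵐ x ∂wallMeasure, 0 ≤ β₁ x + β₂ x) → F ∩ E = ∅) := by
  have hEp := hE.1.isFinitePerimeterSet
  have hFp := hF.1.1.isFinitePerimeterSet
  constructor
  · intro h0 hβ
    obtain ⟨hA, hB⟩ := hEp.union_inter hFp
    have hmin := IsMinimizer.of_exchange hE₀ hF₀ hE hF.1 hA hB (hEp.perimeter_union_inter hFp)
      (wallEnergy_union_inter_le hβ₁ hβ₂ hEp hFp hβ)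
      (dissipation_add_le τ hEp.measurableSet hFp.measurableSet hE₀.measurableSet
        hF₀.measurableSet hA.measurableSet hB.measurableSet
        (indicator_symmDiff_union_inter_le hFp.subset hE₀ hF₀ h0))
    -- Minimality of `F` places it in the density-one set of `E ∩ F`, hence in that of `E`, which is
    -- `E`.
    refine (hF.2 _ hmin).trans ((densityOne_mono Set.inter_subset_left).trans ?_)
    rw [hE.1.densityOne_eq]
  · intro h0 hβ
    obtain ⟨hA, hB⟩ := hEp.diff_diff hFp
    have hmin := IsMinimizer.of_exchange hE₀ hF₀ hE hF.1 hA hB (hEp.perimeter_diff_diff hFp)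
      (wallEnergy_diff_diff_le hβ₁ hβ₂ hEp hFp hβ)
      (dissipation_add_le τ hEp.measurableSet hFp.measurableSet hE₀.measurableSet
        hF₀.measurableSet hA.measurableSet hB.measurableSet
        (indicator_symmDiff_diff_diff_le hE₀ hF₀ h0))
    refine Set.eq_empty_iff_forall_notMem.2 fun x hx => ?_
    -- A common point would be of density one both for `F \ E` and for `E`.
    refine densityOne_disjoint hEp.measurableSet Set.disjoint_sdiff_left (hF.2 _ hmin hx.1) ?_
    rw [hE.1.densityOne_eq]
    exact hx.2
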